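/- Let $p\ge 1$ be an integer and let $\Omega\subset\mathbb{C}$ be a bounded domain (a nonempty connected open set) whose boundary consists of finitely many pairwise disjoint $C^\infty$ smooth regular simple closed curves, with $\Omega$ locally on one side of each; orient $\partial\Omega$ in the standard way (with $\Omega$ on the left). Let $\mathcal{A}^\infty(\Omega)$ be the space of analytic functions on $\Omega$ that are $C^\infty$ smooth up to the boundary. Suppose that $\Omega$ is a one-point quadrature domain for the boundary measure $|z|^{-2p}\,dz$ with node at the origin, that is, $0\in\Omega$ and there is a constant $c\in\mathbb{C}$, $c\neq 0$, such that $$\int_{\partial\Omega}\frac{f(z)}{|z|^{2p}}\,dz=c\,f(0)\qquad\text{for all } f\in\mathcal{A}^\infty(\Omega).$$ Then $\Omega$ is a one-point quadrature domain for the weighted area measure $|z|^{2p-2}\,dA$ with node away from the origin, that is, there are a point $z_0\in\Omega$, $z_0\neq 0$, and a constant $C\in\mathbb{C}$, $C\neq 0$, such that $$\int_{\Omega}f(z)\,|z|^{2p-2}\,dA=C\,f(z_0)\qquad\text{for all } f\in\mathcal{A}^\infty(\Omega).$$ -/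

import Mathlib

open scoped ContDiff

/-- `Ω` is a bounded domain in the plane with `C^∞` smooth boundary, and `γ 0, …, γ (n-1)` are
smooth regular `1`-periodic parametrizations of its boundary curves, in the standard orientation
(the domain lies to the left of each curve). -/
structure IsSmoothBoundedDomain (Ω : Set ℂ) {n : ℕ} (γ : Fin n → ℝ → ℂ) : Prop where
  isOpen : IsOpen Ω
  isConnected : IsConnected Ω
  isBounded : Bornology.IsBounded Ω
  contDiff : ∀ j, ContDiff ℝ ∞ (γ j)
  deriv_ne_zero : ∀ j t, deriv (γ j) t ≠ 0
  periodic : ∀ j, Function.Periodic (γ j) 1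
  injOn : ∀ j, Set.InjOn (γ j) (Set.Ico 0 1)
  disjoint : ∀ i j, i ≠ j → Disjoint (Set.range (γ i)) (Set.range (γ j))
  frontier_eq : frontier Ω = ⋃ j, Set.range (γ j)
  /-- The left normal `i γ'` points into `Ω`, and the right normal `-i γ'` points out of it. -/
  orientation : ∀ j t, ∃ δ : ℝ, 0 < δ ∧ ∀ s : ℝ, 0 < s → s < δ →
    γ j t + s * (Complex.I * deriv (γ j) t) ∈ Ω ∧
    γ j t - s * (Complex.I * deriv (γ j) t) ∉ closure Ω

/-- The boundary integral `∫_{∂Ω} g(z) dz`, for boundary curves `γ j`. -/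
noncomputable def boundaryIntegral {n : ℕ} (γ : Fin n → ℝ → ℂ) (g : ℂ → ℂ) : ℂ :=
  ∑ j, ∫ t in (0 : ℝ)..1, g (γ j t) * deriv (γ j) t

/-- The test class `A^∞(Ω)`: functions that are complex analytic on `Ω` and `C^∞` smooth up to
the boundary. Only the values on `closure Ω` matter. -/
def testClass (Ω : Set ℂ) : Set (ℂ → ℂ) :=
  {f | DifferentiableOn ℂ f Ω ∧ ContDiffOn ℝ ∞ f (closure Ω)}

/-- `Ω`, with boundary curves `γ j`, is a one-point quadrature domain with node `z₀` for the
complex boundary measure `|z|^{-2p} dz`: integration of test functions is a nonzero multiple of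
evaluation at `z₀`. -/
def IsOnePointQDBoundary (Ω : Set ℂ) {n : ℕ} (γ : Fin n → ℝ → ℂ) (p : ℕ) (z₀ : ℂ) : Prop :=
  z₀ ∈ Ω ∧ ∃ c : ℂ, c ≠ 0 ∧ ∀ f ∈ testClass Ω,
    boundaryIntegral γ (fun z => f z / ((‖z‖ ^ (2 * p) : ℝ) : ℂ)) = c * f z₀

/-- `Ω` is a one-point quadrature domain with node `z₀` for the weighted area measure
`|z|^m dA`. -/
def IsOnePointQDArea (Ω : Set ℂ) (m : ℕ) (z₀ : ℂ) : Prop :=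
  z₀ ∈ Ω ∧ ∃ c : ℂ, c ≠ 0 ∧ ∀ f ∈ testClass Ω,
    ∫ z in Ω, f z * ((‖z‖ ^ m : ℝ) : ℂ) = c * f z₀

/-! Testing the hypothesis on Cauchy kernels `1 / (z - w)` with `w` outside the closure shows that
the Cauchy integral of `|z|^{-2p}` equals `-c / w` there. By the Plemelj jump relation its interior
values extend continuously to the boundary, with limit `2πi |z|^{-2p} - c / z`. Dividing by `2πi`,
multiplying by `z` and adding `c / 2πi` gives a holomorphic `G` on `Ω` with `G = z |z|^{-2p}` on the
boundary and `G 0 = c / 2πi ≠ 0` (`exists_holomorphic_of_isOnePointQDBoundary`). Equivalently,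
`z^{p-1} z̄^p = 1 / G` on the boundary.

Green's formula in the form `integral_dbar_eq_zero` says that if `A z̄^p` agrees on the boundary
with a holomorphic function, then `∫_Ω A p z̄^{p-1} dA = 0`. If `G` had no zero, `A = z^{p-1}` would
give `∫_Ω |z|^{2p-2} dA = 0`, which is absurd. On the other hand `G / z > 0` on the boundary, so `G`
can be deformed linearly to `z` without boundary zeros and has at most one zero, counted with
multiplicity (`dslope_ne_zero_of_frontier_pos`). So `G` has exactly one zero `z₀`, it is simple, and
it is not `0`. Then `(f - f z₀) / G` is holomorphic, and Green's formula with `A = (f - f z₀)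
z^{p-1}` gives the area identity, with `C` the total mass of the weight. -/

open Filter Topology Set

/-! ### Normal coordinates and the local shape of the domain -/

/-- The normal coordinates `t + i s ↦ γ t + s · i γ'(t)` along a plane curve. -/
noncomputable def tube (γ : ℝ → ℂ) (z : ℂ) : ℂ :=
  γ z.re + z.im * (Complex.I * deriv γ z.re)

lemma tube_ofReal (γ : ℝ → ℂ) (t : ℝ) : tube γ t = γ t := by simp [tube]

lemma contDiff_deriv {γ : ℝ → ℂ} (hγ : ContDiff ℝ ∞ γ) : ContDiff ℝ ∞ (deriv γ) :=
  (contDiff_infty_iff_deriv.1 hγ).2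

lemma contDiff_tube {γ : ℝ → ℂ} (hγ : ContDiff ℝ ∞ γ) : ContDiff ℝ ∞ (tube γ) := by
  have h1 : ContDiff ℝ ∞ (fun z : ℂ => z.re) := Complex.reCLM.contDiff
  have h2 : ContDiff ℝ ∞ (fun z : ℂ => (z.im : ℂ)) :=
    Complex.ofRealCLM.contDiff.comp Complex.imCLM.contDiff
  have h3 := (contDiff_deriv hγ).comp h1
  exact (hγ.comp h1).add (h2.mul (contDiff_const.mul h3))

lemma continuous_tube {γ : ℝ → ℂ} (hγ : ContDiff ℝ ∞ γ) : Continuous (tube γ) :=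
  (contDiff_tube hγ).continuous

/-- The normal derivative of the tube map is `i` times its tangential derivative along the real
axis, because the `γ''` term carries the factor `im = 0` there. The map is not holomorphic in
general, yet at real points its real derivative is complex linear, so the one-variable inverse
function theorem applies. -/
lemma hasStrictDerivAt_tube {γ : ℝ → ℂ} (hγ : ContDiff ℝ ∞ γ) (t : ℝ) :
    HasStrictDerivAt (tube γ) (deriv γ t) t := by
  have h1 : HasFDerivAt (fun z : ℂ => z.re) Complex.reCLM (t : ℂ) := Complex.reCLM.hasFDerivAt
  have h2 : HasFDerivAt (fun z : ℂ => (z.im : ℂ)) (Complex.ofRealCLM.comp Complex.imCLM) (t : ℂ) :=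
    (Complex.ofRealCLM.comp Complex.imCLM).hasFDerivAt
  have hd : HasFDerivAt γ (fderiv ℝ γ ((t : ℂ).re)) ((t : ℂ).re) :=
    (hγ.differentiable (by simp) _).hasFDerivAt
  have hd2 : HasFDerivAt (deriv γ) (fderiv ℝ (deriv γ) ((t : ℂ).re)) ((t : ℂ).re) :=
    ((contDiff_deriv hγ).differentiable (by simp) _).hasFDerivAt
  have h3 := (hd.comp (t : ℂ) h1).add
    (h2.mul ((hd2.comp (t : ℂ) h1).const_mul Complex.I))
  have h4 : HasStrictFDerivAt (tube γ) _ (t : ℂ) :=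
    (contDiff_tube hγ).contDiffAt.hasStrictFDerivAt' h3 (by simp)
  have h5 : HasStrictFDerivAt (tube γ)
      ((ContinuousLinearMap.toSpanSingleton ℂ (deriv γ t)).restrictScalars ℝ) (t : ℂ) := by
    convert h4 using 1
    ext z
    simp only [ContinuousLinearMap.coe_restrictScalars', ContinuousLinearMap.toSpanSingleton_apply,
      smul_eq_mul, add_apply, ContinuousLinearMap.coe_comp,
      Function.comp_apply, Complex.ofReal_re, Complex.ofReal_im, Complex.ofReal_zero, zero_smul,
      Complex.reCLM_apply, fderiv_eq_smul_deriv, smul_apply,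
      Complex.imCLM_apply, Complex.ofRealCLM_apply, Complex.real_smul, zero_add]
    linear_combination (deriv γ t) * (Complex.re_add_im z).symm
  rw [hasStrictDerivAt_iff_hasStrictFDerivAt]
  exact .of_isLittleO h5.isLittleO

/-- A connected set missing the frontier of `s` and meeting `s` lies in `s`. -/
lemma IsPreconnected.subset_of_disjoint_frontier {X : Type*} [TopologicalSpace X] {u s : Set X}
    (hu : IsPreconnected u) (hd : Disjoint u (frontier s)) (hn : (u ∩ s).Nonempty) : u ⊆ s := by
  have hcov : u ⊆ interior s ∪ (closure s)ᶜ := by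
    intro x hx
    by_cases h1 : x ∈ interior s
    · exact Or.inl h1
    · exact Or.inr fun h2 => (Set.disjoint_left.1 hd hx) ⟨h2, h1⟩
  rcases isPreconnected_iff_subset_of_disjoint.1 hu _ _ isOpen_interior
    isClosed_closure.isOpen_compl hcov (by
      ext x; simp only [mem_inter_iff, mem_compl_iff, mem_empty_iff_false, iff_false]
      exact fun h => h.2.2 (subset_closure (interior_subset h.2.1))) with h | h
  · exact h.trans interior_subset
  · obtain ⟨x, hx, hs⟩ := hn
    exact absurd (subset_closure hs) (h hx)

lemma eq_of_periodic_injOn {γ : ℝ → ℂ} (hp : Function.Periodic γ 1) (hi : InjOn γ (Ico 0 1))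
    {a b : ℝ} (h : γ a = γ b) (hab : |a - b| < 1) : a = b := by
  have key : ∀ x, γ (Int.fract x) = γ x := fun x => by
    have := hp.sub_int_mul_eq (x := x) ⌊x⌋
    rwa [mul_one] at this
  have hf : Int.fract a = Int.fract b := by
    apply hi ⟨Int.fract_nonneg _, Int.fract_lt_one _⟩ ⟨Int.fract_nonneg _, Int.fract_lt_one _⟩
    rw [key, key, h]
  obtain ⟨k, hk⟩ := Int.fract_eq_fract.1 hf
  rw [hk] at hab
  have : |k| < 1 := by exact_mod_cast hab
  have hk0 : k = 0 := Int.abs_lt_one_iff.1 this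
  rw [hk0] at hk
  simpa [sub_eq_zero] using hk

namespace IsSmoothBoundedDomain

variable {Ω : Set ℂ} {n : ℕ} {γ : Fin n → ℝ → ℂ}

lemma mem_frontier (hΩ : IsSmoothBoundedDomain Ω γ) (j : Fin n) (t : ℝ) : γ j t ∈ frontier Ω := by
  rw [hΩ.frontier_eq]; exact mem_iUnion.2 ⟨j, t, rfl⟩

lemma notMem_of_mem_frontier (hΩ : IsSmoothBoundedDomain Ω γ) {z : ℂ} (hz : z ∈ frontier Ω) :
    z ∉ Ω := by
  rw [hΩ.isOpen.frontier_eq] at hz; exact hz.2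

lemma closure_eq (hΩ : IsSmoothBoundedDomain Ω γ) : closure Ω = Ω ∪ frontier Ω := by
  rw [closure_eq_interior_union_frontier, hΩ.isOpen.interior_eq]

lemma isCompact_closure (hΩ : IsSmoothBoundedDomain Ω γ) : IsCompact (closure Ω) :=
  hΩ.isBounded.isCompact_closure

lemma isCompact_frontier (hΩ : IsSmoothBoundedDomain Ω γ) : IsCompact (frontier Ω) :=
  hΩ.isCompact_closure.of_isClosed_subset isClosed_frontier frontier_subset_closure

lemma ne_univ (hΩ : IsSmoothBoundedDomain Ω γ) : Ω ≠ univ := by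
  intro h
  exact NormedSpace.unbounded_univ ℂ ℂ (h ▸ hΩ.isBounded)

lemma frontier_nonempty (hΩ : IsSmoothBoundedDomain Ω γ) : (frontier Ω).Nonempty :=
  nonempty_frontier_iff.2 ⟨hΩ.isConnected.nonempty, hΩ.ne_univ⟩

lemma isCompact_range (hΩ : IsSmoothBoundedDomain Ω γ) (j : Fin n) : IsCompact (range (γ j)) := by
  have : range (γ j) = γ j '' Icc 0 1 := by
    have := (hΩ.periodic j).image_Icc one_pos 0
    simpa using this.symm
  rw [this]
  exact isCompact_Icc.image (hΩ.contDiff j).continuous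

/-- The frontier near a boundary point is a single small boundary arc. -/
lemma eventually_mem_arc (hΩ : IsSmoothBoundedDomain Ω γ) (j : Fin n) (t₀ : ℝ) {r : ℝ}
    (hr : 0 < r) :
    ∀ᶠ z in 𝓝 (γ j t₀), z ∈ frontier Ω → ∃ t, |t - t₀| < r ∧ z = γ j t := by
  have hK1 : ∀ i ∈ (Finset.univ.erase j), ∀ᶠ z in 𝓝 (γ j t₀), z ∉ range (γ i) := by
    intro i hi
    refine (hΩ.isCompact_range i).isClosed.isOpen_compl.mem_nhds fun h => ?_
    exact disjoint_left.1 (hΩ.disjoint i j (Finset.ne_of_mem_erase hi)) h ⟨t₀, rfl⟩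
  -- One period centred at `t₀`, minus the short arc, is compact and misses `γ j t₀`: its parameters
  -- are within `1/2 < 1` of `t₀`, so injectivity modulo the period applies.
  have hK2 : IsCompact (γ j '' (Icc (t₀ - 1 / 2) (t₀ + 1 / 2) \ Ioo (t₀ - r) (t₀ + r))) :=
    (isCompact_Icc.diff isOpen_Ioo).image (hΩ.contDiff j).continuous
  have h2 : ∀ᶠ z in 𝓝 (γ j t₀),
      z ∉ γ j '' (Icc (t₀ - 1 / 2) (t₀ + 1 / 2) \ Ioo (t₀ - r) (t₀ + r)) := by
    refine hK2.isClosed.isOpen_compl.mem_nhds ?_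
    rintro ⟨t, ⟨ht, ht'⟩, he⟩
    have := eq_of_periodic_injOn (hΩ.periodic j) (hΩ.injOn j) he
      (by rw [abs_lt]; constructor <;> linarith [ht.1, ht.2])
    exact ht' (by rw [this]; constructor <;> linarith)
  have h1 := (Finset.eventually_all _).2 hK1
  filter_upwards [h1, h2] with z hz1 hz2 hz
  rw [hΩ.frontier_eq] at hz
  obtain ⟨i, hi⟩ := mem_iUnion.1 hz
  by_cases hij : i = j
  · subst hij
    have him := (hΩ.periodic i).image_Icc one_pos (t₀ - 1 / 2)
    rw [← him] at hi
    obtain ⟨t, ht, rfl⟩ := hi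
    refine ⟨t, ?_, rfl⟩
    by_contra hc
    refine hz2 ⟨t, ⟨⟨ht.1, by linarith [ht.2]⟩, fun h => hc ?_⟩, rfl⟩
    rw [abs_lt]; constructor <;> linarith [h.1, h.2]
  · exact absurd hi (hz1 i (by simp [hij]))

/-- In normal coordinates the domain is the upper half plane near each boundary point. -/
lemma eventually_tube (hΩ : IsSmoothBoundedDomain Ω γ) (j : Fin n) (t₀ : ℝ) :
    ∀ᶠ z in 𝓝 (t₀ : ℂ), (0 < z.im → tube (γ j) z ∈ Ω) ∧
      (z.im < 0 → tube (γ j) z ∉ closure Ω) := by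
  have hst := hasStrictDerivAt_tube (hΩ.contDiff j) t₀
  have hinv := (hst.hasStrictFDerivAt_equiv (hΩ.deriv_ne_zero j t₀)).eventually_left_inverse
  obtain ⟨r, hr, hrinv⟩ := Metric.eventually_nhds_iff.1 hinv
  have hcont : Tendsto (tube (γ j)) (𝓝 (t₀ : ℂ)) (𝓝 (γ j t₀)) := by
    have := (continuous_tube (hΩ.contDiff j)).tendsto (t₀ : ℂ)
    rwa [tube_ofReal] at this
  obtain ⟨r', hr', harc⟩ := Metric.eventually_nhds_iff.1
    (hcont.eventually (hΩ.eventually_mem_arc j t₀ hr))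
  set ρ := min r r' with hρ
  have hρ0 : 0 < ρ := lt_min hr hr'
  -- Near `t₀` a frontier point is `tube t` for a real `t` close to `t₀`, and local injectivity of
  -- the tube map identifies its preimage with `t`. Hence each open half disc has connected image
  -- off the frontier, and one point on the normal at `t₀` decides its side.
  have hmiss : ∀ z ∈ Metric.ball (t₀ : ℂ) ρ, tube (γ j) z ∈ frontier Ω → z.im = 0 := by
    intro z hz hf
    obtain ⟨t, ht, he⟩ := harc (lt_of_lt_of_le hz (min_le_right _ _)) hf
    have h1 := hrinv (lt_of_lt_of_le (Metric.mem_ball.1 hz) (min_le_left _ _))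
    have h2 := hrinv (y := (t : ℂ)) (by
      rw [Complex.dist_eq, ← Complex.ofReal_sub, Complex.norm_real]; exact ht)
    rw [he, ← tube_ofReal (γ j) t] at h1
    rw [← h1, h2]; simp
  have hnear : ∃ s : ℝ, 0 < s ∧ s < ρ ∧ γ j t₀ + s * (Complex.I * deriv (γ j) t₀) ∈ Ω ∧
      γ j t₀ - s * (Complex.I * deriv (γ j) t₀) ∉ closure Ω := by
    obtain ⟨δ, hδ, h⟩ := hΩ.orientation j t₀
    obtain ⟨s, hs0, hs⟩ := exists_between (lt_min hδ hρ0)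
    exact ⟨s, hs0, hs.trans_le (min_le_right _ _), h s hs0 (hs.trans_le (min_le_left _ _))⟩
  obtain ⟨s, hs0, hsρ, hin, hout⟩ := hnear
  have hI : ∀ σ : ℝ, tube (γ j) (t₀ + σ * Complex.I) =
      γ j t₀ + σ * (Complex.I * deriv (γ j) t₀) := by
    intro σ; simp [tube]
  have hball : ∀ σ : ℝ, |σ| < ρ → (t₀ + σ * Complex.I : ℂ) ∈ Metric.ball (t₀ : ℂ) ρ := by
    intro σ hσ; simpa [Complex.dist_eq] using hσ
  filter_upwards [Metric.ball_mem_nhds (t₀ : ℂ) hρ0] with z hz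
  constructor
  · intro him
    have hc : IsPreconnected (tube (γ j) '' (Metric.ball (t₀ : ℂ) ρ ∩ {z | 0 < z.im})) :=
      (((convex_ball _ _).inter (convex_halfSpace_im_gt 0)).isPreconnected).image _
        (continuous_tube (hΩ.contDiff j)).continuousOn
    refine hc.subset_of_disjoint_frontier (s := Ω) ?_ ⟨_, ⟨t₀ + s * Complex.I,
      ⟨hball s (by rwa [abs_of_pos hs0]), by simpa using hs0⟩, rfl⟩, ?_⟩ ⟨z, ⟨hz, him⟩, rfl⟩
    · rw [disjoint_left]
      rintro _ ⟨y, ⟨hy, hy0⟩, rfl⟩ hf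
      exact (ne_of_gt hy0) (hmiss y hy hf)
    · rw [hI]; exact hin
  · intro him
    have hc : IsPreconnected (tube (γ j) '' (Metric.ball (t₀ : ℂ) ρ ∩ {z | z.im < 0})) :=
      (((convex_ball _ _).inter (convex_halfSpace_im_lt 0)).isPreconnected).image _
        (continuous_tube (hΩ.contDiff j)).continuousOn
    refine hc.subset_of_disjoint_frontier (s := (closure Ω)ᶜ) ?_ ⟨_, ⟨t₀ + (-s : ℝ) * Complex.I,
      ⟨hball (-s) (by rwa [abs_neg, abs_of_pos hs0]), by simpa using hs0⟩, rfl⟩, ?_⟩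
      ⟨z, ⟨hz, him⟩, rfl⟩
    · rw [disjoint_left]
      rintro _ ⟨y, ⟨hy, hy0⟩, rfl⟩ hf
      rw [frontier_compl] at hf
      exact (ne_of_lt hy0) (hmiss y hy (frontier_closure_subset hf))
    · rw [hI]
      convert hout using 2
      push_cast; ring

end IsSmoothBoundedDomain

/-! ### Cauchy integrals and the Plemelj jump -/

/-- Differentiation under the integral sign, the kernel being bounded by the distance from `w` to
the arc. It gives holomorphy off the boundary and, for partial arcs, continuity at boundary points
away from them. -/
lemma differentiableAt_cauchyIntegral {γ k : ℝ → ℂ} {a b : ℝ} (hγ : Continuous γ)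
    (hk : Continuous k) {w : ℂ} (hw : w ∉ γ '' uIcc a b) :
    DifferentiableAt ℂ (fun w => ∫ t in a..b, k t / (γ t - w)) w := by
  have hK : IsClosed (γ '' uIcc a b) := (isCompact_uIcc.image hγ).isClosed
  obtain ⟨d, hd, hball⟩ := Metric.isOpen_iff.1 hK.isOpen_compl w hw
  have hfar : ∀ t ∈ uIcc a b, ∀ x ∈ Metric.ball w (d / 2), d / 2 ≤ ‖γ t - x‖ := by
    intro t ht x hx
    have h1 : d ≤ ‖γ t - w‖ := by
      by_contra! h
      exact hball (by rwa [Metric.mem_ball, Complex.dist_eq]) ⟨t, ht, rfl⟩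
    have h2 : ‖x - w‖ < d / 2 := by rwa [Metric.mem_ball, Complex.dist_eq] at hx
    have h3 : γ t - w = (γ t - x) + (x - w) := by ring
    have := norm_add_le (γ t - x) (x - w)
    rw [← h3] at this
    linarith
  have hne : ∀ t ∈ uIcc a b, ∀ x ∈ Metric.ball w (d / 2), γ t - x ≠ 0 := by
    intro t ht x hx h0
    have := hfar t ht x hx
    rw [h0, norm_zero] at this
    linarith
  have hcont : ∀ x ∈ Metric.ball w (d / 2), ContinuousOn (fun t => k t / (γ t - x)) (uIcc a b) :=
    fun x hx => hk.continuousOn.div (hγ.continuousOn.sub continuousOn_const) fun t ht => hne t ht x hx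
  have hw0 : w ∈ Metric.ball w (d / 2) := Metric.mem_ball_self (by positivity)
  have hcont' : ContinuousOn (fun t => k t / (γ t - w) ^ 2) (uIcc a b) :=
    hk.continuousOn.div ((hγ.continuousOn.sub continuousOn_const).pow 2)
      fun t ht => pow_ne_zero _ (hne t ht w hw0)
  refine (intervalIntegral.hasDerivAt_integral_of_dominated_loc_of_deriv_le
    (F := fun x t => k t / (γ t - x)) (F' := fun x t => k t / (γ t - x) ^ 2)
    (bound := fun t => ‖k t‖ / (d / 2) ^ 2) (s := Metric.ball w (d / 2))
    (Metric.ball_mem_nhds w (by positivity)) ?_ (hcont w hw0).intervalIntegrable ?_ ?_ ?_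
    ?_).2.differentiableAt
  · filter_upwards [Metric.ball_mem_nhds w (half_pos hd)] with x hx
    exact ((hcont x hx).mono uIoc_subset_uIcc).aestronglyMeasurable measurableSet_uIoc
  · exact (hcont'.mono uIoc_subset_uIcc).aestronglyMeasurable measurableSet_uIoc
  · refine Eventually.of_forall fun t ht x hx => ?_
    rw [norm_div, norm_pow]
    gcongr
    exact hfar t (uIoc_subset_uIcc ht) x hx
  · exact Continuous.intervalIntegrable (by fun_prop) _ _
  · refine Eventually.of_forall fun t ht x hx => ?_
    have h : HasDerivAt (fun y => k t * (γ t - y)⁻¹) (k t * (-(-1) / (γ t - x) ^ 2)) x :=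
      (((hasDerivAt_id x).const_sub (γ t)).inv (hne t (uIoc_subset_uIcc ht) x hx)).const_mul (k t)
    simpa [div_eq_mul_inv] using h

/-- Distances in normal coordinates are comparable with distances in the plane. -/
lemma tube_lower_bound {γ : ℝ → ℂ} (hγ : ContDiff ℝ ∞ γ) {t₀ : ℝ} (h0 : deriv γ t₀ ≠ 0) :
    ∃ r > 0, ∀ u ∈ Metric.ball (t₀ : ℂ) r, ∀ v ∈ Metric.ball (t₀ : ℂ) r,
      ‖deriv γ t₀‖ / 2 * ‖u - v‖ ≤ ‖tube γ u - tube γ v‖ := by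
  have hst := (hasStrictDerivAt_tube hγ t₀).isLittleO
  have hpos : 0 < ‖deriv γ t₀‖ / 2 := by positivity
  obtain ⟨r, hr, h⟩ := Metric.eventually_nhds_iff.1 (hst.bound hpos)
  refine ⟨r, hr, fun u hu v hv => ?_⟩
  have h1 := h (y := (u, v)) (by rw [Prod.dist_eq]; exact max_lt hu hv)
  simp only [ContinuousLinearMap.toSpanSingleton_apply, smul_eq_mul] at h1
  have h2 : ‖(u - v) * deriv γ t₀‖ ≤ ‖tube γ u - tube γ v‖ +
      ‖tube γ u - tube γ v - (u - v) * deriv γ t₀‖ := by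
    rw [norm_sub_rev (tube γ u - tube γ v)]
    have := norm_add_le (tube γ u - tube γ v) ((u - v) * deriv γ t₀ - (tube γ u - tube γ v))
    simpa using this
  rw [norm_mul] at h2
  linarith [mul_comm ‖u - v‖ ‖deriv γ t₀‖]

/-- Both endpoints move, so an ordinary derivative at `p` would not suffice; strictness makes the
error small relative to `u - v`, hence to `s`. -/
lemma tendsto_slope_of_hasStrictDerivAt {f : ℂ → ℂ} {f' p L : ℂ} (hf : HasStrictDerivAt f f' p)
    {α : Type*} {l : Filter α} {u v s : α → ℂ} (hu : Tendsto u l (𝓝 p)) (hv : Tendsto v l (𝓝 p))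
    (hs : ∀ᶠ x in l, s x ≠ 0) (huv : ∀ᶠ x in l, u x - v x = s x * L) :
    Tendsto (fun x => (f (u x) - f (v x)) / s x) l (𝓝 (f' * L)) := by
  have h1 := hf.isLittleO.comp_tendsto (hu.prodMk_nhds hv)
  have h2 : (fun x => u x - v x) =O[l] s := by
    refine Asymptotics.IsBigO.of_bound ‖L‖ ?_
    filter_upwards [huv] with x hx
    rw [hx, norm_mul, mul_comm]
  have h3 := (h1.trans_isBigO h2).tendsto_div_nhds_zero
  have h4 := h3.add_const (f' * L)
  rw [zero_add] at h4
  refine h4.congr' ?_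
  filter_upwards [hs, huv] with x hx hx2
  simp only [Function.comp_apply, ContinuousLinearMap.toSpanSingleton_apply, smul_eq_mul, hx2]
  field_simp
  ring

/-- The jump of a Cauchy integral over a short arc. -/
lemma tendsto_jump_near {γ k : ℝ → ℂ} (hγ : ContDiff ℝ ∞ γ) (hk : Continuous k) {t₀ : ℝ}
    (h0 : deriv γ t₀ ≠ 0) :
    ∃ r > 0, ∀ δ, 0 < δ → δ < r →
      Tendsto (fun z : ℂ => ∫ t in (t₀ - δ)..(t₀ + δ),
        (k t / (γ t - tube γ z) - k t / (γ t - tube γ ((starRingEnd ℂ) z))))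
        (𝓝[{z : ℂ | 0 < z.im}] (t₀ : ℂ)) (𝓝 (2 * Real.pi * Complex.I * (k t₀ / deriv γ t₀))) := by
  obtain ⟨r, hr, hlow⟩ := tube_lower_bound hγ h0
  refine ⟨r, hr, fun δ hδ hδr => ?_⟩
  set a := deriv γ t₀ with ha
  set l : Filter ℂ := 𝓝[{z : ℂ | 0 < z.im}] (t₀ : ℂ) with hl
  have hlim : ∀ᶠ z in l, 0 < z.im := self_mem_nhdsWithin
  have hld : Tendsto (fun z : ℂ => z) l (𝓝 (t₀ : ℂ)) := nhdsWithin_le_nhds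
  have hre : Tendsto (fun z : ℂ => z.re) l (𝓝 t₀) := by
    simpa [Function.comp_def] using (Complex.continuous_re.tendsto (t₀ : ℂ)).comp hld
  have him : Tendsto (fun z : ℂ => z.im) l (𝓝 0) := by
    simpa [Function.comp_def] using (Complex.continuous_im.tendsto (t₀ : ℂ)).comp hld
  have hconj : Tendsto (fun z : ℂ => (starRingEnd ℂ) z) l (𝓝 (t₀ : ℂ)) := by
    simpa [Function.comp_def] using (Complex.continuous_conj.tendsto (t₀ : ℂ)).comp hld
  let J : ℂ → ℝ → ℂ := fun z =>
    indicator (Ioc (t₀ - δ) (t₀ + δ)) fun t =>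
        (k t / (γ t - tube γ z) - k t / (γ t - tube γ ((starRingEnd ℂ) z)))
  -- The substitution `t = re z + (im z) x` blows the arc up at scale `im z`. The rescaled integrand
  -- converges to `2i (k t₀ / a) / (1 + x²)`, whose integral over the line is `2πi k t₀ / a`.
  let F : ℂ → ℝ → ℂ := fun z x => z.im * J z (z.re + z.im * x)
  have hJF : ∀ᶠ z in l, ∫ x, F z x = ∫ t in (t₀ - δ)..(t₀ + δ),
        (k t / (γ t - tube γ z) - k t / (γ t - tube γ ((starRingEnd ℂ) z))) := by
    filter_upwards [hlim] with z hz
    rw [intervalIntegral.integral_of_le (by linarith),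
      ← MeasureTheory.integral_indicator measurableSet_Ioc]
    change ∫ x, (z.im : ℂ) * J z (z.re + z.im * x) = ∫ t, J z t
    rw [MeasureTheory.integral_const_mul,
      MeasureTheory.Measure.integral_comp_mul_left (fun y => J z (z.re + y)),
      MeasureTheory.integral_add_left_eq_self, abs_of_pos (inv_pos.2 hz), Complex.real_smul,
      ← mul_assoc, ← Complex.ofReal_mul, mul_inv_cancel₀ hz.ne']
    simp
  refine Tendsto.congr' hJF ?_
  have hlimit : (2 * Real.pi * Complex.I * (k t₀ / a) : ℂ) =
      ∫ x : ℝ, (k t₀ / a) * (2 * Complex.I) * (((1 + x ^ 2)⁻¹ : ℝ) : ℂ) := by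
    rw [MeasureTheory.integral_const_mul, integral_complex_ofReal, integral_univ_inv_one_add_sq]
    ring
  rw [hlimit]
  obtain ⟨Mk, hMk⟩ := (isCompact_Icc (a := t₀ - δ) (b := t₀ + δ)).exists_bound_of_continuousOn
    hk.continuousOn
  obtain ⟨Md, hMd⟩ := (isCompact_Icc (a := t₀ - δ) (b := t₀ + δ)).exists_bound_of_continuousOn
    (contDiff_deriv hγ).continuous.continuousOn
  have hMk0 : 0 ≤ Mk := (norm_nonneg _).trans (hMk t₀ ⟨by linarith, by linarith⟩)
  have hMd0 : 0 ≤ Md := (norm_nonneg _).trans (hMd t₀ ⟨by linarith, by linarith⟩)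
  have ha0 : 0 < ‖a‖ := norm_pos_iff.2 h0
  have hball : ∀ᶠ z in l, z ∈ Metric.ball (t₀ : ℂ) r := hld (Metric.ball_mem_nhds _ hr)
  have hball' : ∀ᶠ z in l, (starRingEnd ℂ) z ∈ Metric.ball (t₀ : ℂ) r :=
    hconj (Metric.ball_mem_nhds _ hr)
  have hreI : ∀ᶠ z in l, z.re ∈ Icc (t₀ - δ) (t₀ + δ) :=
    hre (Icc_mem_nhds (by linarith) (by linarith))
  -- The reflected points differ by exactly `2 (im z) i γ'(re z)`, so the combined fraction has no
  -- error term in its numerator.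
  have hdiff : ∀ z : ℂ, tube γ z - tube γ ((starRingEnd ℂ) z) =
      2 * z.im * (Complex.I * deriv γ z.re) := by
    intro z; simp [tube]; ring
  have hpt : ∀ (z : ℂ) (x : ℝ), ((z.re + z.im * x : ℝ) : ℂ) - z = z.im * (x - Complex.I) := by
    intro z x
    push_cast
    linear_combination Complex.re_add_im z
  have hpt' : ∀ (z : ℂ) (x : ℝ), ((z.re + z.im * x : ℝ) : ℂ) - (starRingEnd ℂ) z =
      z.im * (x + Complex.I) := by
    intro z x
    have : (starRingEnd ℂ) z = z.re - z.im * Complex.I := by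
      apply Complex.ext <;> simp
    rw [this]
    push_cast
    ring
  have hnsq : ∀ x : ℝ, ‖(x - Complex.I : ℂ)‖ * ‖(x + Complex.I : ℂ)‖ = 1 + x ^ 2 := by
    intro x
    rw [← norm_mul]
    have : (x - Complex.I : ℂ) * (x + Complex.I) = ((1 + x ^ 2 : ℝ) : ℂ) := by
      push_cast; ring_nf; simp; ring
    rw [this, Complex.norm_real, Real.norm_of_nonneg (by positivity)]
  have hIne : ∀ x : ℝ, (x - Complex.I : ℂ) ≠ 0 ∧ (x + Complex.I : ℂ) ≠ 0 := by
    intro x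
    have h := hnsq x
    constructor <;> intro h' <;> rw [h'] at h <;> simp at h <;> nlinarith [sq_nonneg x]
  -- The two lower bounds multiply to a constant times `(im z)² (1 + x²)`; the `(im z)²` cancels
  -- against the numerator, leaving an integrable majorant independent of `z`.
  have hFval : ∀ z : ℂ, 0 < z.im → z ∈ Metric.ball (t₀ : ℂ) r →
      (starRingEnd ℂ) z ∈ Metric.ball (t₀ : ℂ) r → ∀ x : ℝ,
      z.re + z.im * x ∈ Ioc (t₀ - δ) (t₀ + δ) →
      (‖a‖ / 2 * (z.im * ‖(x - Complex.I : ℂ)‖) ≤ ‖γ (z.re + z.im * x) - tube γ z‖ ∧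
      ‖a‖ / 2 * (z.im * ‖(x + Complex.I : ℂ)‖) ≤
        ‖γ (z.re + z.im * x) - tube γ ((starRingEnd ℂ) z)‖) ∧
      F z x = k (z.re + z.im * x) * (2 * Complex.I * deriv γ z.re) * z.im ^ 2 /
        ((γ (z.re + z.im * x) - tube γ z) *
          (γ (z.re + z.im * x) - tube γ ((starRingEnd ℂ) z))) := by
    intro z hz hb hb' x hx
    have hu : ((z.re + z.im * x : ℝ) : ℂ) ∈ Metric.ball (t₀ : ℂ) r := by
      rw [Metric.mem_ball, Complex.dist_eq, ← Complex.ofReal_sub, Complex.norm_real,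
        Real.norm_eq_abs, abs_lt]
      constructor <;> linarith [hx.1, hx.2]
    have e1 := hlow _ hu _ hb
    have e2 := hlow _ hu _ hb'
    rw [hpt, norm_mul, Complex.norm_real, Real.norm_of_nonneg hz.le, tube_ofReal] at e1
    rw [hpt', norm_mul, Complex.norm_real, Real.norm_of_nonneg hz.le, tube_ofReal] at e2
    have n1 : γ (z.re + z.im * x) - tube γ z ≠ 0 := by
      rw [← norm_pos_iff]
      exact lt_of_lt_of_le (by have := norm_pos_iff.2 (hIne x).1; positivity) e1
    have n2 : γ (z.re + z.im * x) - tube γ ((starRingEnd ℂ) z) ≠ 0 := by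
      rw [← norm_pos_iff]
      exact lt_of_lt_of_le (by have := norm_pos_iff.2 (hIne x).2; positivity) e2
    refine ⟨⟨e1, e2⟩, ?_⟩
    simp only [F, J, indicator_of_mem hx]
    rw [div_sub_div _ _ n1 n2, mul_div_assoc']
    congr 1
    linear_combination z.im * k (z.re + z.im * x) * hdiff z
  refine MeasureTheory.tendsto_integral_filter_of_dominated_convergence
    (fun x => Mk * (2 * Md) / (‖a‖ / 2) ^ 2 * (1 + x ^ 2)⁻¹) ?_ ?_ ?_ ?_
  · filter_upwards [hlim, hball, hball'] with z hz hb hb'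
    have hJm : Measurable (J z) := by
      have hcγ := hγ.continuous.measurable
      have hck := hk.measurable
      exact Measurable.indicator (by fun_prop) measurableSet_Ioc
    exact (measurable_const.mul (hJm.comp (by fun_prop))).aestronglyMeasurable
  · filter_upwards [hlim, hball, hball', hreI] with z hz hb hb' hzI
    refine Eventually.of_forall fun x => ?_
    by_cases hx : z.re + z.im * x ∈ Ioc (t₀ - δ) (t₀ + δ)
    · obtain ⟨⟨e1, e2⟩, e3⟩ := hFval z hz hb hb' x hx
      rw [e3, norm_div, norm_mul, norm_mul, norm_mul, norm_mul, norm_mul, norm_pow,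
        Complex.norm_real, Real.norm_of_nonneg hz.le, Complex.norm_I, Complex.norm_two, mul_one]
      have hkx := hMk _ (Ioc_subset_Icc_self hx)
      have hdx := hMd _ hzI
      have hden : (‖a‖ / 2) ^ 2 * z.im ^ 2 * (1 + x ^ 2) ≤
          ‖γ (z.re + z.im * x) - tube γ z‖ *
            ‖γ (z.re + z.im * x) - tube γ ((starRingEnd ℂ) z)‖ := by
        refine le_trans (le_of_eq ?_) (mul_le_mul e1 e2 (by positivity) (norm_nonneg _))
        rw [← hnsq x]; ring
      have hx2 : 0 < 1 + x ^ 2 := by positivity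
      calc _ ≤ Mk * (2 * Md) * z.im ^ 2 / ((‖a‖ / 2) ^ 2 * z.im ^ 2 * (1 + x ^ 2)) := by
            gcongr
        _ = _ := by field_simp
    · simp only [F, J, indicator_of_notMem hx, mul_zero, norm_zero]
      positivity
  · exact integrable_inv_one_add_sq.const_mul _
  · refine Eventually.of_forall fun x => ?_
    have hxt : Tendsto (fun z : ℂ => z.re + z.im * x) l (𝓝 t₀) := by
      simpa using hre.add (him.mul_const x)
    have hxI : ∀ᶠ z in l, z.re + z.im * x ∈ Ioc (t₀ - δ) (t₀ + δ) :=
      hxt (Ioc_mem_nhds (by linarith) (by linarith))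
    have hu : Tendsto (fun z : ℂ => ((z.re + z.im * x : ℝ) : ℂ)) l (𝓝 (t₀ : ℂ)) :=
      (Complex.continuous_ofReal.tendsto t₀).comp hxt
    have hs0 : ∀ᶠ z in l, (z.im : ℂ) ≠ 0 := hlim.mono fun z hz => by
      exact_mod_cast hz.ne'
    have q1 := tendsto_slope_of_hasStrictDerivAt (hasStrictDerivAt_tube hγ t₀) hu hld hs0
      (Eventually.of_forall fun z => hpt z x)
    have q2 := tendsto_slope_of_hasStrictDerivAt (hasStrictDerivAt_tube hγ t₀) hu hconj hs0
      (Eventually.of_forall fun z => hpt' z x)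
    have q3 : Tendsto (fun z : ℂ => k (z.re + z.im * x)) l (𝓝 (k t₀)) :=
      (hk.tendsto t₀).comp hxt
    have q4 : Tendsto (fun z : ℂ => deriv γ z.re) l (𝓝 a) :=
      ((contDiff_deriv hγ).continuous.tendsto t₀).comp hre
    have q := (q3.mul (q4.const_mul (2 * Complex.I))).div (q1.mul q2)
      (mul_ne_zero (mul_ne_zero h0 (hIne x).1) (mul_ne_zero h0 (hIne x).2))
    have hval : k t₀ * (2 * Complex.I * a) / (a * (x - Complex.I) * (a * (x + Complex.I))) =
        (k t₀ / a) * (2 * Complex.I) * (((1 + x ^ 2)⁻¹ : ℝ) : ℂ) := by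
      have hprod : ((1 + x ^ 2 : ℝ) : ℂ) = (x - Complex.I : ℂ) * (x + Complex.I) := by
        push_cast; ring_nf; simp; ring
      rw [Complex.ofReal_inv, hprod]
      have := (hIne x).1
      have := (hIne x).2
      field_simp
    rw [← hval]
    refine q.congr' ?_
    filter_upwards [hlim, hball, hball', hxI, hs0] with z hz hb hb' hx hz0
    rw [(hFval z hz hb hb' x hx).2]
    simp only [Pi.div_apply, tube_ofReal]
    rw [div_mul_div_comm, div_div_eq_mul_div]
    congr 1
    ring

namespace IsSmoothBoundedDomain

variable {Ω : Set ℂ} {n : ℕ} {γ : Fin n → ℝ → ℂ}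

lemma boundaryIntegral_cauchy (γ : Fin n → ℝ → ℂ) (g : ℂ → ℂ) (w : ℂ) :
    boundaryIntegral γ (fun z => g z / (z - w)) =
      ∑ j, ∫ t in (0 : ℝ)..1, g (γ j t) * deriv (γ j) t / (γ j t - w) := by
  unfold boundaryIntegral
  simp only [div_mul_eq_mul_div]

lemma continuous_density (hΩ : IsSmoothBoundedDomain Ω γ) {g : ℂ → ℂ}
    (hg : ContinuousOn g (frontier Ω)) (j : Fin n) :
    Continuous fun t => g (γ j t) * deriv (γ j) t :=
  (hg.comp_continuous (hΩ.contDiff j).continuous (hΩ.mem_frontier j)).mul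
    (contDiff_deriv (hΩ.contDiff j)).continuous

lemma differentiableAt_boundaryIntegral (hΩ : IsSmoothBoundedDomain Ω γ) {g : ℂ → ℂ}
    (hg : ContinuousOn g (frontier Ω)) {w : ℂ} (hw : w ∉ frontier Ω) :
    DifferentiableAt ℂ (fun w => boundaryIntegral γ (fun z => g z / (z - w))) w := by
  simp only [boundaryIntegral_cauchy]
  refine DifferentiableAt.fun_sum fun j _ => ?_
  refine differentiableAt_cauchyIntegral (hΩ.contDiff j).continuous (hΩ.continuous_density hg j) ?_
  rintro ⟨t, -, rfl⟩
  exact hw (hΩ.mem_frontier j t)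

lemma intervalIntegrable_cauchy (hΩ : IsSmoothBoundedDomain Ω γ) {g : ℂ → ℂ}
    (hg : ContinuousOn g (frontier Ω)) (j : Fin n) {w : ℂ} (hw : w ∉ frontier Ω) (a b : ℝ) :
    IntervalIntegrable (fun t => g (γ j t) * deriv (γ j) t / (γ j t - w)) MeasureTheory.volume
      a b := by
  refine Continuous.intervalIntegrable ((hΩ.continuous_density hg j).div
    ((hΩ.contDiff j).continuous.sub continuous_const) fun t ht => ?_) _ _
  have ht : γ j t = w := sub_eq_zero.1 ht
  exact hw (ht ▸ hΩ.mem_frontier j t)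

/-- Near a boundary point a Cauchy integral differs by a continuous function from the integral
over a short arc. -/
lemma boundaryIntegral_eq_arc_add (hΩ : IsSmoothBoundedDomain Ω γ) {g : ℂ → ℂ}
    (hg : ContinuousOn g (frontier Ω)) (j : Fin n) (t₀ : ℝ) {δ : ℝ} (hδ : 0 < δ) (hδ' : δ < 1 / 2) :
    ∃ R : ℂ → ℂ, ContinuousAt R (γ j t₀) ∧ ∀ w ∉ frontier Ω,
      boundaryIntegral γ (fun z => g z / (z - w)) =
        (∫ t in (t₀ - δ)..(t₀ + δ), g (γ j t) * deriv (γ j) t / (γ j t - w)) + R w := by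
  refine ⟨fun w => (∑ i ∈ Finset.univ.erase j, ∫ t in (0 : ℝ)..1,
      g (γ i t) * deriv (γ i) t / (γ i t - w)) +
      ((∫ t in (t₀ - 1 / 2)..(t₀ - δ), g (γ j t) * deriv (γ j) t / (γ j t - w)) +
       ∫ t in (t₀ + δ)..(t₀ + 1 / 2), g (γ j t) * deriv (γ j) t / (γ j t - w)), ?_, ?_⟩
  · refine ContinuousAt.add ?_ (ContinuousAt.add ?_ ?_)
    · refine tendsto_finsetSum _ fun i hi => ?_
      refine (differentiableAt_cauchyIntegral (hΩ.contDiff i).continuous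
        (hΩ.continuous_density hg i) ?_).continuousAt
      rintro ⟨t, -, h⟩
      exact disjoint_left.1 (hΩ.disjoint i j (Finset.ne_of_mem_erase hi)) ⟨t, rfl⟩ ⟨t₀, h.symm⟩
    · refine (differentiableAt_cauchyIntegral (hΩ.contDiff j).continuous
        (hΩ.continuous_density hg j) ?_).continuousAt
      rintro ⟨t, ht, h⟩
      rw [uIcc_of_le (by linarith)] at ht
      have := eq_of_periodic_injOn (hΩ.periodic j) (hΩ.injOn j) h
        (by rw [abs_lt]; constructor <;> linarith [ht.1, ht.2])
      linarith [ht.2]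
    · refine (differentiableAt_cauchyIntegral (hΩ.contDiff j).continuous
        (hΩ.continuous_density hg j) ?_).continuousAt
      rintro ⟨t, ht, h⟩
      rw [uIcc_of_le (by linarith)] at ht
      have := eq_of_periodic_injOn (hΩ.periodic j) (hΩ.injOn j) h
        (by rw [abs_lt]; constructor <;> linarith [ht.1, ht.2])
      linarith [ht.1]
  · intro w hw
    have hI := hΩ.intervalIntegrable_cauchy hg j hw
    have hper : Function.Periodic (fun t => g (γ j t) * deriv (γ j) t / (γ j t - w)) 1 := by
      intro t
      have h1 := hΩ.periodic j
      have h2 : deriv (γ j) (t + 1) = deriv (γ j) t := by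
        rw [← deriv_comp_add_const]
        congr 1
        funext s
        exact h1 s
      simp only [h2, h1 t]
    have h1 := hper.intervalIntegral_add_eq 0 (t₀ - 1 / 2)
    rw [zero_add, show t₀ - 1 / 2 + 1 = t₀ + 1 / 2 by ring] at h1
    rw [boundaryIntegral_cauchy, ← Finset.add_sum_erase _ _ (Finset.mem_univ j), h1,
      ← intervalIntegral.integral_add_adjacent_intervals (hI _ (t₀ - δ)) (hI _ _),
      ← intervalIntegral.integral_add_adjacent_intervals (hI (t₀ - δ) (t₀ + δ)) (hI _ _)]
    ring

/-- The Plemelj jump relation. -/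
lemma tendsto_jump (hΩ : IsSmoothBoundedDomain Ω γ) {g : ℂ → ℂ}
    (hg : ContinuousOn g (frontier Ω)) (j : Fin n) (t₀ : ℝ) :
    Tendsto (fun z : ℂ => boundaryIntegral γ (fun ζ => g ζ / (ζ - tube (γ j) z)) -
        boundaryIntegral γ (fun ζ => g ζ / (ζ - tube (γ j) ((starRingEnd ℂ) z))))
      (𝓝[{z : ℂ | 0 < z.im}] (t₀ : ℂ)) (𝓝 (2 * Real.pi * Complex.I * g (γ j t₀))) := by
  have hd := hΩ.deriv_ne_zero j t₀
  obtain ⟨r, hr, hnear⟩ := tendsto_jump_near (hΩ.contDiff j) (hΩ.continuous_density hg j) hd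
  obtain ⟨δ, hδ, hδ'⟩ := exists_between (lt_min hr (by norm_num : (0 : ℝ) < 1 / 2))
  obtain ⟨R, hR, hCR⟩ := hΩ.boundaryIntegral_eq_arc_add hg j t₀ hδ (hδ'.trans_le (min_le_right _ _))
  have hN := hnear δ hδ (hδ'.trans_le (min_le_left _ _))
  rw [mul_div_cancel_right₀ _ hd] at hN
  have hld : Tendsto (fun z : ℂ => z) (𝓝[{z : ℂ | 0 < z.im}] (t₀ : ℂ)) (𝓝 (t₀ : ℂ)) :=
    nhdsWithin_le_nhds
  have hconj : Tendsto (fun z : ℂ => (starRingEnd ℂ) z) (𝓝[{z : ℂ | 0 < z.im}] (t₀ : ℂ))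
      (𝓝 (t₀ : ℂ)) := by
    simpa [Function.comp_def] using (Complex.continuous_conj.tendsto (t₀ : ℂ)).comp hld
  have htube : Tendsto (tube (γ j)) (𝓝 (t₀ : ℂ)) (𝓝 (γ j t₀)) := by
    have := (continuous_tube (hΩ.contDiff j)).tendsto (t₀ : ℂ)
    rwa [tube_ofReal] at this
  -- The part of the Cauchy integral away from the short arc is continuous at the boundary point, so
  -- it contributes nothing to the jump.
  have hRlim := ((hR.tendsto.comp (htube.comp hld)).sub (hR.tendsto.comp (htube.comp hconj)))
  rw [sub_self] at hRlim
  have := hN.add hRlim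
  rw [add_zero] at this
  refine this.congr' ?_
  filter_upwards [hld.eventually (hΩ.eventually_tube j t₀),
    hconj.eventually (hΩ.eventually_tube j t₀), self_mem_nhdsWithin] with z h1 h2 hz
  have n1 : tube (γ j) z ∉ frontier Ω := fun h => hΩ.notMem_of_mem_frontier h (h1.1 hz)
  have n2 : tube (γ j) ((starRingEnd ℂ) z) ∉ frontier Ω := fun h =>
    h2.2 (by simpa using hz) (frontier_subset_closure h)
  rw [hCR _ n1, hCR _ n2, intervalIntegral.integral_sub (hΩ.intervalIntegrable_cauchy hg j n1 _ _)
    (hΩ.intervalIntegrable_cauchy hg j n2 _ _)]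
  simp only [Function.comp_apply]
  ring

/-- If the Cauchy integral of `g` agrees outside the domain with a function `E` continuous at the
boundary, then `g + E / 2πi` is the boundary function of a holomorphic function. -/
lemma exists_holomorphic_extension (hΩ : IsSmoothBoundedDomain Ω γ) {g E : ℂ → ℂ}
    (hg : ContinuousOn g (frontier Ω)) (hE : ∀ z ∈ frontier Ω, ContinuousAt E z)
    (hgE : ∀ w ∉ closure Ω, boundaryIntegral γ (fun z => g z / (z - w)) = E w) :
    ∃ h : ℂ → ℂ, DifferentiableOn ℂ h Ω ∧ ContinuousOn h (closure Ω) ∧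
      ∀ z ∈ frontier Ω, h z = g z + E z / (2 * Real.pi * Complex.I) := by
  classical
  set κ : ℂ := 2 * Real.pi * Complex.I with hκ
  have hκ0 : κ ≠ 0 := Complex.two_pi_I_ne_zero
  set C : ℂ → ℂ := fun w => boundaryIntegral γ (fun z => g z / (z - w)) with hC
  have hdiff : DifferentiableOn ℂ (fun w => C w / κ) Ω := fun w hw =>
    ((hΩ.differentiableAt_boundaryIntegral hg fun h =>
      hΩ.notMem_of_mem_frontier h hw).div_const κ).differentiableWithinAt
  have hlim : ∀ ζ ∈ frontier Ω, Tendsto C (𝓝[Ω] ζ) (𝓝 (κ * g ζ + E ζ)) := by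
    intro ζ hζ
    obtain ⟨j, t₀, rfl⟩ := by
      have h := hζ
      rw [hΩ.frontier_eq] at h
      exact mem_iUnion.1 h
    -- The tube map carries neighbourhoods of `t₀` onto neighbourhoods of the boundary point, and
    -- the preimage of `Ω` is locally the upper half plane. A limit over the whole half plane, not
    -- just along the normal, thus becomes a limit within `Ω`.
    have hmap := (hasStrictDerivAt_tube (hΩ.contDiff j) t₀).map_nhds_eq (hΩ.deriv_ne_zero j t₀)
    rw [tube_ofReal] at hmap
    have hld : Tendsto (fun z : ℂ => z) (𝓝[{z : ℂ | 0 < z.im}] (t₀ : ℂ)) (𝓝 (t₀ : ℂ)) :=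
      nhdsWithin_le_nhds
    have hconj : Tendsto (fun z : ℂ => (starRingEnd ℂ) z) (𝓝[{z : ℂ | 0 < z.im}] (t₀ : ℂ))
        (𝓝 (t₀ : ℂ)) := by
      simpa [Function.comp_def] using (Complex.continuous_conj.tendsto (t₀ : ℂ)).comp hld
    have htube : Tendsto (tube (γ j)) (𝓝 (t₀ : ℂ)) (𝓝 (γ j t₀)) := hmap.le
    have hEl := (hE _ hζ).tendsto.comp (htube.comp hconj)
    have hsum : Tendsto (fun z => C (tube (γ j) z)) (𝓝[{z : ℂ | 0 < z.im}] (t₀ : ℂ))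
        (𝓝 (κ * g (γ j t₀) + E (γ j t₀))) := by
      -- The interior value is the jump plus the value at the reflected exterior point, where the
      -- Cauchy integral is `E`.
      refine ((hΩ.tendsto_jump hg j t₀).add hEl).congr' ?_
      filter_upwards [hconj.eventually (hΩ.eventually_tube j t₀), self_mem_nhdsWithin] with z h2 hz
      simp only [Function.comp_apply]
      rw [← hgE _ (h2.2 (by simpa using hz))]
      ring
    intro s hs
    rw [mem_map, mem_nhdsWithin_iff_eventually, ← hmap, eventually_map]
    have h1 := eventually_nhdsWithin_iff.1 (hsum.eventually hs)
    filter_upwards [h1, hΩ.eventually_tube j t₀] with z hz1 hz2 hzΩ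
    refine hz1 ?_
    rcases lt_trichotomy z.im 0 with h | h | h
    · exact absurd (subset_closure hzΩ) (hz2.2 h)
    · exfalso
      refine hΩ.notMem_of_mem_frontier (hΩ.mem_frontier j z.re) ?_
      simpa [tube, h] using hzΩ
    · exact h
  refine ⟨Ω.piecewise (fun w => C w / κ) (fun w => g w + E w / κ), ?_, ?_, ?_⟩
  · exact hdiff.congr fun w hw => piecewise_eq_of_mem _ _ _ hw
  · intro ζ hζ
    rw [hΩ.closure_eq] at hζ ⊢
    rcases hζ with hζ | hζ
    · refine ContinuousAt.continuousWithinAt ?_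
      refine ((hdiff ζ hζ).differentiableAt (hΩ.isOpen.mem_nhds hζ)).continuousAt.congr ?_
      filter_upwards [hΩ.isOpen.mem_nhds hζ] with w hw
      exact (piecewise_eq_of_mem Ω (fun w => C w / κ) (fun w => g w + E w / κ) hw).symm
    · have hval : Ω.piecewise (fun w => C w / κ) (fun w => g w + E w / κ) ζ = g ζ + E ζ / κ :=
        piecewise_eq_of_notMem _ _ _ (hΩ.notMem_of_mem_frontier hζ)
      refine ContinuousWithinAt.union ?_ ?_
      · rw [ContinuousWithinAt, hval]
        have h2 := (hlim ζ hζ).div_const κ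
        rw [add_div, mul_div_cancel_left₀ _ hκ0] at h2
        refine h2.congr' ?_
        filter_upwards [self_mem_nhdsWithin] with w hw
        exact (piecewise_eq_of_mem Ω (fun w => C w / κ) (fun w => g w + E w / κ) hw).symm
      · have h2 : ContinuousWithinAt (fun w => g w + E w / κ) (frontier Ω) ζ :=
          (hg ζ hζ).add ((hE ζ hζ).continuousWithinAt.div_const κ)
        exact h2.congr (fun w hw => piecewise_eq_of_notMem _ _ _ (hΩ.notMem_of_mem_frontier hw)) hval
  · intro z hz
    exact piecewise_eq_of_notMem _ _ _ (hΩ.notMem_of_mem_frontier hz)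

end IsSmoothBoundedDomain

/-! ### Counting zeros by deformation -/

/-- The difference quotient of a holomorphic function is jointly continuous. -/
lemma continuousAt_dslope_uncurry {f : ℂ → ℂ} {s : Set ℂ} (hs : IsOpen s)
    (hf : DifferentiableOn ℂ f s) {a b : ℂ} (ha : a ∈ s) (hb : b ∈ s) :
    ContinuousAt (fun q : ℂ × ℂ => dslope f q.1 q.2) (a, b) := by
  by_cases hab : a = b
  · subst hab
    have hst : HasStrictDerivAt f (deriv f a) a :=
      (hf.analyticAt (hs.mem_nhds ha)).hasStrictDerivAt
    have hd : ContinuousAt (deriv f) a := (hf.analyticAt (hs.mem_nhds ha)).deriv.continuousAt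
    rw [Metric.continuousAt_iff']
    intro ε hε
    have h1 := hst.isLittleO.bound (half_pos hε)
    have h2 : ∀ᶠ q : ℂ × ℂ in 𝓝 (a, a), dist (deriv f q.1) (deriv f a) < ε :=
      (hd.comp continuousAt_fst (x := (a, a))).eventually (Metric.ball_mem_nhds _ hε)
    filter_upwards [h1, h2] with q hq1 hq2
    rw [dslope_same]
    by_cases hq : q.2 = q.1
    · rw [hq, dslope_same]; exact hq2
    · rw [dslope_of_ne _ hq, slope_def_field, Complex.dist_eq]
      have hne : q.1 - q.2 ≠ 0 := sub_ne_zero.2 (Ne.symm hq)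
      have hne' : q.2 - q.1 ≠ 0 := sub_ne_zero.2 hq
      have : (f q.2 - f q.1) / (q.2 - q.1) - deriv f a =
          (f q.1 - f q.2 - (q.1 - q.2) * deriv f a) / (q.1 - q.2) := by
        field_simp
        ring
      rw [this, norm_div]
      simp only [ContinuousLinearMap.toSpanSingleton_apply, smul_eq_mul] at hq1
      rw [div_lt_iff₀ (norm_pos_iff.2 hne)]
      have := norm_pos_iff.2 hne
      nlinarith
  · have hfa : ContinuousAt f a := ((hf a ha).differentiableAt (hs.mem_nhds ha)).continuousAt
    have hfb : ContinuousAt f b := ((hf b hb).differentiableAt (hs.mem_nhds hb)).continuousAt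
    have h : ContinuousAt (fun q : ℂ × ℂ => (f q.2 - f q.1) / (q.2 - q.1)) (a, b) := by
      refine ContinuousAt.div ?_ (by fun_prop) (sub_ne_zero.2 (Ne.symm hab))
      exact (hfb.comp continuousAt_snd (x := (a, b))).sub (hfa.comp continuousAt_fst (x := (a, b)))
    refine h.congr ?_
    have : ∀ᶠ q : ℂ × ℂ in 𝓝 (a, b), q.1 ≠ q.2 :=
      (isOpen_ne_fun continuous_fst continuous_snd).mem_nhds hab
    filter_upwards [this] with q hq
    rw [dslope_of_ne _ (Ne.symm hq), slope_def_field]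

/-- Zeros of holomorphic functions persist under perturbation. -/
lemma eventually_exists_zero {X : Type*} [TopologicalSpace X] {P : X → ℂ → ℂ} {s : Set ℂ}
    (hs : IsOpen s) {x₀ : X} {b : ℂ} (hb : b ∈ s) (hd : ∀ᶠ x in 𝓝 x₀, DifferentiableOn ℂ (P x) s)
    (hc : ∀ z ∈ s, ContinuousAt (fun q : X × ℂ => P q.1 q.2) (x₀, z)) (h0 : P x₀ b = 0)
    (hne : ¬ ∀ᶠ z in 𝓝 b, P x₀ z = 0) {ε : ℝ} (hε : 0 < ε) :
    ∀ᶠ x in 𝓝 x₀, ∃ z ∈ Metric.ball b ε ∩ s, P x z = 0 := by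
  have hnz := ((hd.self_of_nhds.analyticAt
    (hs.mem_nhds hb)).eventually_eq_zero_or_eventually_ne_zero).resolve_left hne
  rw [eventually_nhdsWithin_iff] at hnz
  obtain ⟨r₁, hr₁, h₁⟩ := Metric.eventually_nhds_iff.1 hnz
  obtain ⟨r₂, hr₂, h₂⟩ := Metric.isOpen_iff.1 hs b hb
  obtain ⟨r, hr, hrm⟩ := exists_between (lt_min hε (lt_min hr₁ hr₂))
  simp only [lt_min_iff] at hrm
  have hsub : Metric.closedBall b r ⊆ s := (Metric.closedBall_subset_ball hrm.2.2).trans h₂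
  have hsph : IsCompact (Metric.sphere b r) := isCompact_sphere b r
  have hsphne : (Metric.sphere b r).Nonempty := NormedSpace.sphere_nonempty.2 hr.le
  have hcs : ContinuousOn (fun z => ‖P x₀ z‖) (Metric.sphere b r) :=
    (hd.self_of_nhds.continuousOn.mono (Metric.sphere_subset_closedBall.trans hsub)).norm
  obtain ⟨z₁, hz₁, hmin⟩ := hsph.exists_isMinOn hsphne hcs
  set m := ‖P x₀ z₁‖ with hm
  have hm0 : 0 < m := by
    refine norm_pos_iff.2 (h₁ ?_ ?_)
    · rw [Metric.mem_sphere.1 hz₁]; exact hrm.2.1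
    · rintro rfl
      simp at hz₁
      exact hr.ne hz₁
  have e1 : ∀ᶠ x in 𝓝 x₀, ∀ z ∈ Metric.sphere b r, m / 2 < ‖P x z‖ := by
    refine hsph.eventually_forall_of_forall_eventually fun z hz => ?_
    have hcz := (hc z (hsub (Metric.sphere_subset_closedBall hz))).norm
    refine hcz.eventually (lt_mem_nhds ?_)
    have : m ≤ ‖P x₀ z‖ := hmin hz
    simp only
    linarith
  have e2 : ∀ᶠ x in 𝓝 x₀, ‖P x b‖ < m / 2 := by
    have h3 : ContinuousAt (fun x => ‖P x b‖) x₀ :=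
      ((hc b hb).comp (f := fun x => (x, b)) (by fun_prop)).norm
    refine h3.eventually (gt_mem_nhds ?_)
    simp only [h0, norm_zero]; positivity
  filter_upwards [hd, e1, e2] with x hx he1 he2
  by_contra! hcon
  have hnz' : ∀ z ∈ Metric.closedBall b r, P x z ≠ 0 := fun z hz =>
    hcon z ⟨Metric.closedBall_subset_ball hrm.1 hz, hsub hz⟩
  -- With no zero in the disc, the maximum principle for `1 / P x` would force `‖P x b‖ ≥ m / 2`.
  have hdiff : DifferentiableOn ℂ (fun z => (P x z)⁻¹) (Metric.closedBall b r) :=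
    (hx.mono hsub).inv hnz'
  have hdc : DiffContOnCl ℂ (fun z => (P x z)⁻¹) (Metric.ball b r) :=
    DifferentiableOn.diffContOnCl (by rwa [closure_ball b hr.ne'])
  have := Complex.norm_le_of_forall_mem_frontier_norm_le Metric.isBounded_ball hdc (C := (m / 2)⁻¹)
    (fun z hz => by
      rw [frontier_ball b hr.ne'] at hz
      rw [norm_inv]
      exact inv_anti₀ (by positivity) (he1 z hz).le) (subset_closure (Metric.mem_ball_self hr))
  rw [norm_inv] at this
  have hb0 : 0 < ‖P x b‖ := norm_pos_iff.2 (hnz' b (Metric.mem_closedBall_self hr.le))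
  have := (inv_le_inv₀ hb0 (by positivity)).1 this
  linarith

/-- If `G z / z > 0` on the frontier, then `G` has at most one zero, counted with multiplicity. -/
lemma dslope_ne_zero_of_frontier_pos {s : Set ℂ} (hs : IsOpen s) (hconn : IsConnected s)
    (hbdd : Bornology.IsBounded s) {G : ℂ → ℂ} (hG : DifferentiableOn ℂ G s)
    (hGc : ContinuousOn G (closure s)) {ρ : ℂ → ℝ}
    (hρ : ∀ z ∈ frontier s, 0 < ρ z) (hGρ : ∀ z ∈ frontier s, G z = ρ z * z)
    (h0 : (0 : ℂ) ∉ frontier s) (hfr : (frontier s).Nonempty) {a b : ℂ} (ha : a ∈ s) (hb : b ∈ s)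
    (hGa : G a = 0) : dslope G a b ≠ 0 := by
  -- `F` deforms `z` to `G`, and `D σ a b` is the difference quotient of `F σ`. The pair `F σ a =
  -- 0`, `D σ a b = 0` encodes two zeros with multiplicity, `b = a` being a double zero. On the
  -- frontier `F σ z` is a positive multiple of `z`.
  set F : ℝ → ℂ → ℂ := fun σ z => σ * G z + (1 - σ) * z with hF
  set D : ℝ → ℂ → ℂ → ℂ := fun σ a b => σ * dslope G a b + (1 - σ) with hD
  have hFfr : ∀ σ ∈ Icc (0 : ℝ) 1, ∀ z ∈ frontier s, F σ z ≠ 0 := by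
    intro σ hσ z hz hz0
    have hz' : z ≠ 0 := fun h => h0 (h ▸ hz)
    have : ((σ * ρ z + (1 - σ) : ℝ) : ℂ) * z = 0 := by
      rw [← hz0, hF]; simp only [hGρ z hz]; push_cast; ring
    rcases mul_eq_zero.1 this with h | h
    · have h' : σ * ρ z + (1 - σ) = 0 := by exact_mod_cast h
      have := hρ z hz
      rcases eq_or_lt_of_le hσ.1 with h1 | h1
      · rw [← h1] at h'; norm_num at h'
      · nlinarith [hσ.2, mul_pos h1 this]
    · exact hz' h
  have hFD : ∀ σ a b, F σ b = F σ a + (b - a) * D σ a b := by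
    intro σ a b
    have := sub_smul_dslope G a b
    simp only [smul_eq_mul] at this
    simp only [hF, hD]
    linear_combination -(σ : ℂ) * this
  have hFd : ∀ σ, DifferentiableOn ℂ (F σ) s := fun σ =>
    (hG.const_mul _).add (differentiableOn_id.const_mul _)
  have hFne : ∀ σ ∈ Icc (0 : ℝ) 1, ∀ z ∈ s, ¬ ∀ᶠ w in 𝓝 z, F σ w = 0 := by
    intro σ hσ z hz hev
    have han : AnalyticOnNhd ℂ (F σ) s := (hFd σ).analyticOnNhd hs
    have h1 := han.eqOn_zero_of_preconnected_of_eventuallyEq_zero hconn.isPreconnected hz hev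
    obtain ⟨ζ, hζ⟩ := hfr
    have hcl : EqOn (F σ) 0 (closure s) :=
      h1.of_subset_closure (by
        simp only [hF]
        exact (continuousOn_const.mul hGc).add (continuousOn_const.mul continuousOn_id))
        continuousOn_const subset_closure subset_rfl
    exact hFfr σ hσ ζ hζ (hcl (frontier_subset_closure hζ))
  -- `T` collects the parameters with two zeros. It is clopen in `[0, 1]` and omits `0`, where `D =
  -- 1`, so it is empty by connectedness.
  set T : Set (Icc (0 : ℝ) 1) := {σ | ∃ a ∈ s, ∃ b ∈ s, F σ a = 0 ∧ D σ a b = 0} with hT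
  have hDd : ∀ σ, ∀ a ∈ s, DifferentiableOn ℂ (D σ a) s := fun σ a ha =>
    (((Complex.differentiableOn_dslope (hs.mem_nhds ha)).2 hG).const_mul _).add_const _
  have hDc : ∀ σ : ℝ, ∀ a ∈ s, ∀ b ∈ s,
      ContinuousAt (fun q : ℝ × ℂ × ℂ => D q.1 q.2.1 q.2.2) (σ, a, b) := by
    intro σ a ha b hb
    have h1 : ContinuousAt (fun q : ℝ × ℂ × ℂ => dslope G q.2.1 q.2.2) (σ, a, b) :=
      (continuousAt_dslope_uncurry hs hG ha hb).comp (x := (σ, a, b))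
        (f := fun q : ℝ × ℂ × ℂ => q.2) continuousAt_snd
    have h2 : Continuous (fun q : ℝ × ℂ × ℂ => (q.1 : ℂ)) := by fun_prop
    exact (h2.continuousAt.mul h1).add (continuousAt_const.sub h2.continuousAt)
  have hFc : ∀ σ : ℝ, ∀ a ∈ s, ContinuousAt (fun q : ℝ × ℂ => F q.1 q.2) (σ, a) := by
    intro σ a ha
    have h1 : ContinuousAt (fun q : ℝ × ℂ => G q.2) (σ, a) :=
      ((hG a ha).differentiableAt (hs.mem_nhds ha)).continuousAt.comp (x := (σ, a))
        (f := fun q : ℝ × ℂ => q.2) continuousAt_snd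
    have h2 : Continuous (fun q : ℝ × ℂ => (q.1 : ℂ)) := by fun_prop
    exact (h2.continuousAt.mul h1).add
      ((continuousAt_const.sub h2.continuousAt).mul continuousAt_snd)
  have hopen : IsOpen T := by
    rw [isOpen_iff_mem_nhds]
    rintro ⟨σ, hσ⟩ ⟨a, ha, b, hb, hFa, hDab⟩
    -- Hurwitz twice: zeros `b` of the quotient persist for all `(σ', a')` near `(σ, a)`, and then
    -- the zero of `F σ'` is taken close enough to `a` to serve as `a'`.
    have hQ : ∀ᶠ q : ℝ × ℂ in 𝓝 (σ, a), ∃ z ∈ Metric.ball b 1 ∩ s, D q.1 q.2 z = 0 := by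
      refine eventually_exists_zero (P := fun q : ℝ × ℂ => D q.1 q.2) hs hb ?_ ?_ hDab ?_ one_pos
      · have : ∀ᶠ q : ℝ × ℂ in 𝓝 (σ, a), q.2 ∈ s :=
          continuousAt_snd (hs.mem_nhds ha)
        filter_upwards [this] with q hq
        exact hDd q.1 q.2 hq
      · intro z hz
        exact (hDc σ a ha z hz).comp (x := ((σ, a), z))
          (f := fun q : (ℝ × ℂ) × ℂ => (q.1.1, q.1.2, q.2)) (by fun_prop)
      · intro hev
        refine hFne σ hσ b hb (hev.mono fun w hw => ?_)
        rw [hFD σ a w, hFa, hw]; ring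
    rw [nhds_prod_eq, (Metric.nhds_basis_ball.prod Metric.nhds_basis_ball).eventually_iff] at hQ
    obtain ⟨⟨ε₁, ε₂⟩, ⟨hε₁, hε₂⟩, hQ⟩ := hQ
    have hZ : ∀ᶠ σ' in 𝓝 σ, ∃ z ∈ Metric.ball a ε₂ ∩ s, F σ' z = 0 :=
      eventually_exists_zero hs ha (Eventually.of_forall hFd) (fun z hz => hFc σ z hz) hFa
        (hFne σ hσ a ha) hε₂
    have h3 : ∀ᶠ σ' in 𝓝 σ, ∃ a ∈ s, ∃ b ∈ s, F σ' a = 0 ∧ D σ' a b = 0 := by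
      filter_upwards [hZ, Metric.ball_mem_nhds σ hε₁] with σ' ⟨z, ⟨hzb, hzs⟩, hz0⟩ hσ'
      obtain ⟨w, ⟨-, hws⟩, hw0⟩ := hQ (x := (σ', z)) ⟨hσ', hzb⟩
      exact ⟨z, hzs, w, hws, hz0, hw0⟩
    exact continuous_subtype_val.continuousAt (x := (⟨σ, hσ⟩ : Icc (0 : ℝ) 1)) h3
  have hclosed : IsClosed T := by
    refine IsSeqClosed.isClosed fun u σ hu hlim => ?_
    choose x hx y hy hxF hxD using hu
    have hK : IsCompact (closure s ×ˢ closure s) :=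
      hbdd.isCompact_closure.prod hbdd.isCompact_closure
    obtain ⟨⟨a, b⟩, ⟨ha, hb⟩, φ, hφ, hφlim⟩ := hK.tendsto_subseq
      (x := fun n => (x n, y n)) fun n => ⟨subset_closure (hx n), subset_closure (hy n)⟩
    have hσl : Tendsto (fun n => ((u (φ n) : ℝ) : ℂ)) atTop (𝓝 ((σ : ℝ) : ℂ)) :=
      (Complex.continuous_ofReal.tendsto _).comp ((continuous_subtype_val.tendsto σ).comp
        (hlim.comp hφ.tendsto_atTop))
    have hσl' : Tendsto (fun n => (u (φ n) : ℝ)) atTop (𝓝 (σ : ℝ)) :=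
      (continuous_subtype_val.tendsto σ).comp (hlim.comp hφ.tendsto_atTop)
    have hxl : Tendsto (fun n => x (φ n)) atTop (𝓝 a) := (continuous_fst.tendsto _).comp hφlim
    have hyl : Tendsto (fun n => y (φ n)) atTop (𝓝 b) := (continuous_snd.tendsto _).comp hφlim
    have hyF : ∀ n, F (u n) (y n) = 0 := by
      intro n; rw [hFD _ (x n), hxF, hxD]; ring
    have hlimF : ∀ {v : ℕ → ℂ} {c : ℂ}, (∀ n, v n ∈ s) → c ∈ closure s →
        Tendsto (fun n => v (φ n)) atTop (𝓝 c) → (∀ n, F (u n) (v n) = 0) → F σ c = 0 := by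
      intro v c hv hc hvl hv0
      have hGl : Tendsto (fun n => G (v (φ n))) atTop (𝓝 (G c)) :=
        (hGc c hc).tendsto.comp (tendsto_nhdsWithin_iff.2
          ⟨hvl, Eventually.of_forall fun n => subset_closure (hv _)⟩)
      have h1 : Tendsto (fun n => F (u (φ n)) (v (φ n))) atTop (𝓝 (F σ c)) :=
        (hσl.mul hGl).add ((tendsto_const_nhds.sub hσl).mul hvl)
      refine tendsto_nhds_unique h1 ?_
      simp only [hv0]
      exact tendsto_const_nhds
    -- Limits of zeros cannot escape to the frontier, as `F σ` has no zero there.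
    have hin : ∀ {c : ℂ}, c ∈ closure s → F σ c = 0 → c ∈ s := by
      intro c hc hc0
      by_contra hcs
      exact hFfr σ σ.2 c (by rw [hs.frontier_eq]; exact ⟨hc, hcs⟩) hc0
    have hFa := hlimF hx ha hxl hxF
    have hFb := hlimF hy hb hyl hyF
    refine ⟨a, hin ha hFa, b, hin hb hFb, hFa, ?_⟩
    have h1 := (hDc σ a (hin ha hFa) b (hin hb hFb)).tendsto.comp
      (hσl'.prodMk_nhds (hxl.prodMk_nhds hyl))
    refine tendsto_nhds_unique h1 ?_
    simp only [Function.comp_def, hxD]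
    exact tendsto_const_nhds
  have h0T : (⟨0, by simp⟩ : Icc (0 : ℝ) 1) ∉ T := by
    rintro ⟨a, -, b, -, -, h⟩
    simp [hD] at h
  have hTe : T = ∅ := by
    rcases isClopen_iff.1 ⟨hclosed, hopen⟩ with h | h
    · exact h
    · rw [h] at h0T; exact absurd (mem_univ _) h0T
  intro hab
  have h1T : (⟨1, by simp⟩ : Icc (0 : ℝ) 1) ∈ T :=
    ⟨a, ha, b, hb, by simp [hF, hGa], by simp [hD, hab]⟩
  rw [hTe] at h1T
  exact h1T

/-! ### Green's formula by cutoffs -/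

/-- Smooth approximations of indicator functions at scale `ε`, with gradients of order `1 / ε`. -/
lemma exists_mollified_indicator : ∃ C : ℝ, 0 ≤ C ∧ ∀ ε : ℝ, 0 < ε → ∀ A : Set ℂ,
    MeasurableSet A → ∃ χ : ℂ → ℂ, ContDiff ℝ 1 χ ∧ (∀ z, ‖fderiv ℝ χ z‖ ≤ C / ε) ∧
      (∀ z, Metric.ball z ε ⊆ A → χ z = 1) ∧ (∀ z, Disjoint (Metric.ball z ε) A → χ z = 0) ∧
      ∀ z, ‖1 - χ z‖ ≤ 2 := by
  let ρ : ContDiffBump (0 : ℂ) := ⟨1 / 2, 1, by norm_num, by norm_num⟩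
  let f : ℂ → ℝ := ρ.normed MeasureTheory.volume
  let B := (ContinuousLinearMap.lsmul ℝ ℝ : ℝ →L[ℝ] ℂ →L[ℝ] ℂ)
  let L := ContinuousLinearMap.precompL ℂ B
  have hf : ContDiff ℝ 1 f := ρ.contDiff_normed
  have hfc : HasCompactSupport f := ρ.hasCompactSupport_normed
  have hint : MeasureTheory.Integrable (fun t => ‖L‖ * ‖fderiv ℝ f t‖) :=
    (((hf.continuous_fderiv one_ne_zero).integrable_of_hasCompactSupport
      (hfc.fderiv ℝ)).norm).const_mul _
  refine ⟨∫ t, ‖L‖ * ‖fderiv ℝ f t‖, MeasureTheory.integral_nonneg fun t => by positivity, ?_⟩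
  intro ε hε A hA
  -- One fixed bump is convolved with the indicator of the dilated set `A / ε` and the result
  -- rescaled, so the gradient constant depends on neither `A` nor `ε`.
  let s : ℂ → ℂ := fun w => (ε : ℂ) * w
  let g : ℂ → ℂ := indicator (s ⁻¹' A) fun _ => 1
  have hsm : MeasurableSet (s ⁻¹' A) := hA.preimage (by fun_prop)
  have hgm : MeasureTheory.AEStronglyMeasurable g MeasureTheory.volume :=
    (MeasureTheory.stronglyMeasurable_const.indicator hsm).aestronglyMeasurable
  have hg1 : ∀ z, ‖g z‖ ≤ 1 := fun z => by
    simp only [g]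
    refine (norm_indicator_le_norm_self _ _).trans (by simp)
  have hgl : MeasureTheory.LocallyIntegrable g MeasureTheory.volume :=
    (MeasureTheory.locallyIntegrable_const (1 : ℂ)).mono hgm
      (Eventually.of_forall fun z => by simpa using hg1 z)
  let Ψ : ℂ → ℂ := MeasureTheory.convolution f g B MeasureTheory.volume
  have hΨ : ContDiff ℝ 1 Ψ := hfc.contDiff_convolution_left (n := 1) B hf hgl
  have hΨd : ∀ z, ‖fderiv ℝ Ψ z‖ ≤ ∫ t, ‖L‖ * ‖fderiv ℝ f t‖ := by
    intro z
    rw [(hfc.hasFDerivAt_convolution_left B hf hgl z).fderiv]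
    refine MeasureTheory.norm_integral_le_of_norm_le hint (Eventually.of_forall fun t => ?_)
    refine (ContinuousLinearMap.le_opNorm₂ L _ _).trans ?_
    exact mul_le_of_le_one_right (by positivity) (hg1 _)
  let σ : ℂ →L[ℝ] ℂ := ε⁻¹ • ContinuousLinearMap.id ℝ ℂ
  have hσ : ∀ z, σ z = (ε : ℂ)⁻¹ * z := fun z => by simp [σ]
  have hball : ∀ z w, w ∈ Metric.ball (σ z) ρ.rOut → s w ∈ Metric.ball z ε := by
    intro z w hw
    have hε0 : (ε : ℂ) ≠ 0 := by exact_mod_cast hε.ne'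
    rw [Metric.mem_ball, Complex.dist_eq, hσ] at hw
    rw [Metric.mem_ball, Complex.dist_eq]
    have : s w - z = ε * (w - (ε : ℂ)⁻¹ * z) := by simp only [s]; field_simp
    rw [this, norm_mul, Complex.norm_real, Real.norm_of_nonneg hε.le]
    have : ‖w - (ε : ℂ)⁻¹ * z‖ < 1 := hw
    nlinarith
  have hself : ∀ z, σ z ∈ Metric.ball (σ z) ρ.rOut := fun z => Metric.mem_ball_self ρ.rOut_pos
  refine ⟨fun z => Ψ (σ z), hΨ.comp σ.contDiff, ?_, ?_, ?_, ?_⟩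
  · intro z
    have hd := ((hΨ.differentiable one_ne_zero (σ z)).hasFDerivAt).comp z σ.hasFDerivAt
    have hd' : fderiv ℝ (fun z => Ψ (σ z)) z = (fderiv ℝ Ψ (σ z)).comp σ := hd.fderiv
    rw [hd', div_eq_mul_inv]
    refine (ContinuousLinearMap.opNorm_comp_le _ _).trans ?_
    refine mul_le_mul (hΨd _) ?_ (norm_nonneg _) (MeasureTheory.integral_nonneg fun t => by
      positivity)
    refine ContinuousLinearMap.opNorm_le_bound _ (by positivity) fun w => ?_
    rw [hσ, norm_mul, norm_inv, Complex.norm_real, Real.norm_of_nonneg hε.le]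
  · intro z hz
    have h1 : ∀ w ∈ Metric.ball (σ z) ρ.rOut, g w = 1 := fun w hw =>
      indicator_of_mem (s := s ⁻¹' A) (hz (hball z w hw)) _
    have := ContDiffBump.normed_convolution_eq_right (μ := MeasureTheory.volume) (φ := ρ) (g := g)
      (x₀ := σ z) fun w hw => by rw [h1 w hw, h1 _ (hself z)]
    exact this.trans (h1 _ (hself z))
  · intro z hz
    have h1 : ∀ w ∈ Metric.ball (σ z) ρ.rOut, g w = 0 := fun w hw =>
      indicator_of_notMem (s := s ⁻¹' A) (disjoint_left.1 hz (hball z w hw)) _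
    have := ContDiffBump.normed_convolution_eq_right (μ := MeasureTheory.volume) (φ := ρ) (g := g)
      (x₀ := σ z) fun w hw => by rw [h1 w hw, h1 _ (hself z)]
    exact this.trans (h1 _ (hself z))
  · intro z
    have hd : ∀ x y, dist (g x) (g y) ≤ 1 := by
      intro x y
      simp only [g, indicator]
      split_ifs <;> simp
    have h1 : dist (Ψ (σ z)) (g (σ z)) ≤ 1 :=
      ContDiffBump.dist_normed_convolution_le (φ := ρ) hgm fun w _ => hd w _
    have h2 : ‖1 - g (σ z)‖ ≤ 1 := by
      simp only [g, indicator]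
      split_ifs <;> simp
    rw [dist_comm, Complex.dist_eq] at h1
    calc ‖1 - Ψ (σ z)‖ = ‖(1 - g (σ z)) + (g (σ z) - Ψ (σ z))‖ := by ring_nf
      _ ≤ 2 := (norm_add_le _ _).trans (by linarith)

namespace IsSmoothBoundedDomain

variable {Ω : Set ℂ} {n : ℕ} {γ : Fin n → ℝ → ℂ}

/-- The `ε`-neighbourhood of the boundary has area of order `ε`. -/
lemma volume_cthickening_frontier_le (hΩ : IsSmoothBoundedDomain Ω γ) :
    ∃ C : ℝ, 0 ≤ C ∧ ∀ ε : ℝ, 0 < ε → ε ≤ 1 →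
      MeasureTheory.volume (Metric.cthickening ε (frontier Ω)) ≤ ENNReal.ofReal (C * ε) := by
  have hb : ∀ j, ∃ M, ∀ t ∈ Icc (0 : ℝ) 1, ‖deriv (γ j) t‖ ≤ M := fun j =>
    isCompact_Icc.exists_bound_of_continuousOn
      (contDiff_deriv (hΩ.contDiff j)).continuous.continuousOn
  choose M hM using hb
  set Λ := ∑ j, |M j| with hΛ
  have hΛ0 : 0 ≤ Λ := Finset.sum_nonneg fun _ _ => abs_nonneg _
  have hlip : ∀ j, ∀ x ∈ Icc (0 : ℝ) 1, ∀ y ∈ Icc (0 : ℝ) 1, ‖γ j y - γ j x‖ ≤ Λ * ‖y - x‖ := by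
    intro j x hx y hy
    refine Convex.norm_image_sub_le_of_norm_deriv_le
      (fun t _ => (hΩ.contDiff j).differentiable (by simp) t) (fun t ht => ?_) (convex_Icc _ _) hx hy
    exact (hM j t ht).trans ((le_abs_self _).trans
      (Finset.single_le_sum (f := fun j => |M j|) (fun _ _ => abs_nonneg _) (Finset.mem_univ j)))
  -- Each curve is sampled at `N + 1` parameters with `N = ⌈1 / ε⌉`. Discs of radius `ε + Λ ε`
  -- cover, `Λ` bounding the speeds, and `(N + 1) ε ≤ 3` for `ε ≤ 1`.
  refine ⟨3 * n * (1 + Λ) ^ 2 * Real.pi, by positivity, fun ε hε hε1 => ?_⟩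
  set N := ⌈1 / ε⌉₊ with hN
  have hN1 : 1 / ε ≤ N := Nat.le_ceil _
  have hN2 : (N : ℝ) < 1 / ε + 1 := Nat.ceil_lt_add_one (by positivity)
  have hN0 : (0 : ℝ) < N := lt_of_lt_of_le (by positivity) hN1
  set R := ε * (1 + Λ) with hR
  have hcov : Metric.cthickening ε (frontier Ω) ⊆
      ⋃ q ∈ (Finset.univ ×ˢ Finset.range (N + 1) : Finset (Fin n × ℕ)),
        Metric.closedBall (γ q.1 (q.2 / N)) R := by
    intro z hz
    rw [hΩ.isCompact_frontier.cthickening_eq_biUnion_closedBall hε.le] at hz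
    obtain ⟨ζ, hζ, hzζ⟩ := mem_iUnion₂.1 hz
    rw [hΩ.frontier_eq] at hζ
    obtain ⟨j, hj⟩ := mem_iUnion.1 hζ
    have him : range (γ j) = γ j '' Icc 0 1 := by
      simpa using ((hΩ.periodic j).image_Icc one_pos 0).symm
    rw [him] at hj
    obtain ⟨t, ht, rfl⟩ := hj
    have hk1 : (⌊t * N⌋₊ : ℝ) ≤ t * N := Nat.floor_le (mul_nonneg ht.1 hN0.le)
    have hk2 : t * N < ⌊t * N⌋₊ + 1 := Nat.lt_floor_add_one _
    have hkN : (⌊t * N⌋₊ : ℝ) ≤ N := hk1.trans (by nlinarith [ht.2])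
    refine mem_iUnion₂.2 ⟨(j, ⌊t * N⌋₊), ?_, ?_⟩
    · have : ⌊t * N⌋₊ ≤ N := by exact_mod_cast hkN
      simp only [Finset.mem_product, Finset.mem_univ, Finset.mem_range, true_and]
      omega
    · rw [Metric.mem_closedBall, Complex.dist_eq] at hzζ ⊢
      have h1 := hlip j (⌊t * N⌋₊ / N) ⟨by positivity, by rw [div_le_one hN0]; exact hkN⟩ t ht
      have h2 : ‖t - ⌊t * N⌋₊ / N‖ ≤ ε := by
        have h3 : t - ⌊t * N⌋₊ / N = (t * N - ⌊t * N⌋₊) / N := by field_simp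
        rw [h3, Real.norm_of_nonneg (div_nonneg (by linarith) hN0.le), div_le_iff₀ hN0]
        have : 1 ≤ ε * N := by
          rw [div_le_iff₀ hε] at hN1; linarith
        linarith
      calc ‖z - γ j (⌊t * N⌋₊ / N)‖ = ‖(z - γ j t) + (γ j t - γ j (⌊t * N⌋₊ / N))‖ := by ring_nf
        _ ≤ ε + Λ * ε := (norm_add_le _ _).trans
            (add_le_add hzζ (h1.trans (mul_le_mul_of_nonneg_left h2 hΛ0)))
        _ = R := by rw [hR]; ring
  refine (MeasureTheory.measure_mono hcov).trans
    ((MeasureTheory.measure_biUnion_finset_le _ _).trans ?_)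
  have hvol : ∀ c : ℂ, MeasureTheory.volume (Metric.closedBall c R) =
      ENNReal.ofReal (R ^ 2 * Real.pi) := by
    intro c
    rw [Complex.volume_closedBall, ENNReal.ofReal_mul (p := R ^ 2) (by positivity),
      ENNReal.ofReal_pow (p := R) (by positivity)]
    congr 1
    exact (ENNReal.ofReal_coe_nnreal (p := NNReal.pi)).symm
  simp only [hvol, Finset.sum_const, Finset.card_product, Finset.card_univ, Fintype.card_fin,
    Finset.card_range, nsmul_eq_mul]
  rw [← ENNReal.ofReal_natCast, ← ENNReal.ofReal_mul (by positivity)]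
  refine ENNReal.ofReal_le_ofReal ?_
  have hNε : ((N : ℝ) + 1) * ε ≤ 3 := by
    have : 1 / ε * ε = 1 := by field_simp
    nlinarith
  push_cast
  calc (n : ℝ) * (N + 1) * (R ^ 2 * Real.pi)
      = ((N + 1) * ε) * (n * (1 + Λ) ^ 2 * Real.pi * ε) := by rw [hR]; ring
    _ ≤ 3 * (n * (1 + Λ) ^ 2 * Real.pi * ε) := by gcongr
    _ = _ := by ring

end IsSmoothBoundedDomain

lemma integrable_mul_of_tsupport_subset {f g : ℂ → ℂ} {s : Set ℂ} (hs : IsOpen s)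
    (hf : ContinuousOn f s) (hg : Continuous g) (hgc : HasCompactSupport g) (hgs : tsupport g ⊆ s) :
    MeasureTheory.Integrable fun z => f z * g z := by
  have hsub : tsupport (fun z => f z * g z) ⊆ tsupport g := tsupport_mul_subset_right
  refine Continuous.integrable_of_hasCompactSupport
    ((hf.mul hg.continuousOn).continuous_of_tsupport_subset hs (hsub.trans hgs)) ?_
  exact hgc.of_isClosed_subset (isClosed_tsupport _) hsub

/-- Integration by parts for the Cauchy–Riemann operator against a cutoff. -/
lemma integral_dbar_mul_cutoff {s : Set ℂ} (hs : IsOpen s) {A B : ℂ → ℂ}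
    (hA : DifferentiableOn ℂ A s) (hB : DifferentiableOn ℂ B s) (p : ℕ) {χ : ℂ → ℂ}
    (hχ : ContDiff ℝ 1 χ) (hχc : HasCompactSupport χ) (hχs : tsupport χ ⊆ s) :
    ∫ z, 2 * (A z * (p * (starRingEnd ℂ) z ^ (p - 1))) * χ z =
      -∫ z, (A z * (starRingEnd ℂ) z ^ p - B z) *
        (fderiv ℝ χ z 1 + Complex.I * fderiv ℝ χ z Complex.I) := by
  -- `∂₁ + i ∂_I` is `2 ∂̄`, whence the factor `2`. The terms with `A'` and `B'` cancel through `1 +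
  -- i² = 0`.
  set U : ℂ → ℂ := fun z => A z * (starRingEnd ℂ) z ^ p - B z with hU
  set U' : ℂ → ℂ → ℂ := fun z v => deriv A z * v * (starRingEnd ℂ) z ^ p +
    A z * (p * (starRingEnd ℂ) z ^ (p - 1) * (starRingEnd ℂ) v) - deriv B z * v with hU'
  have hUd : ∀ z ∈ s, DifferentiableAt ℝ U z ∧ ∀ v, fderiv ℝ U z v = U' z v := by
    intro z hz
    have h1 : HasFDerivAt A _ z :=
      ((hA z hz).differentiableAt (hs.mem_nhds hz)).hasDerivAt.hasFDerivAt.restrictScalars ℝ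
    have h2 : HasFDerivAt B _ z :=
      ((hB z hz).differentiableAt (hs.mem_nhds hz)).hasDerivAt.hasFDerivAt.restrictScalars ℝ
    have h3 : HasFDerivAt (fun z : ℂ => (starRingEnd ℂ) z) (Complex.conjCLE : ℂ →L[ℝ] ℂ) z :=
      Complex.conjCLE.hasFDerivAt
    have h4 := (h1.mul (h3.pow p)).sub h2
    refine ⟨h4.differentiableAt, fun v => ?_⟩
    have h5 : fderiv ℝ U z = _ := h4.fderiv
    rw [h5]
    simp [hU']
    ring
  have hUc : ContinuousOn U s := fun z hz => (hUd z hz).1.continuousAt.continuousWithinAt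
  have hU'c : ∀ v, ContinuousOn (fun z => fderiv ℝ U z v) s := by
    intro v
    have hconj : ContinuousOn (fun z : ℂ => (starRingEnd ℂ) z) s :=
      Complex.continuous_conj.continuousOn
    have h1 := (hA.deriv hs).continuousOn
    have h2 := (hB.deriv hs).continuousOn
    have h3 : ContinuousOn (fun z => U' z v) s :=
      (((h1.mul continuousOn_const).mul (hconj.pow p)).add (hA.continuousOn.mul
        ((continuousOn_const.mul (hconj.pow (p - 1))).mul continuousOn_const))).sub
        (h2.mul continuousOn_const)
    exact h3.congr fun z hz => (hUd z hz).2 v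
  have hχd : ∀ v, Continuous (fun z => fderiv ℝ χ z v) := fun v =>
    (hχ.continuous_fderiv one_ne_zero).clm_apply continuous_const
  have hχdc : ∀ v, HasCompactSupport (fun z => fderiv ℝ χ z v) := fun v =>
    hχc.fderiv_apply ℝ v
  have hχds : ∀ v, tsupport (fun z => fderiv ℝ χ z v) ⊆ s := fun v =>
    (tsupport_fderiv_apply_subset ℝ v).trans hχs
  have i1 : ∀ v, MeasureTheory.Integrable fun z => fderiv ℝ U z v * χ z := fun v =>
    integrable_mul_of_tsupport_subset hs (hU'c v) hχ.continuous hχc hχs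
  have i2 : ∀ v, MeasureTheory.Integrable fun z => U z * fderiv ℝ χ z v := fun v =>
    integrable_mul_of_tsupport_subset hs hUc (hχd v) (hχdc v) (hχds v)
  have i3 : MeasureTheory.Integrable fun z => U z * χ z :=
    integrable_mul_of_tsupport_subset hs hUc hχ.continuous hχc hχs
  have key : ∀ v, ∫ z, U z * fderiv ℝ χ z v = -∫ z, fderiv ℝ U z v * χ z := fun v =>
    integral_mul_fderiv_eq_neg_fderiv_mul_of_integrable (i1 v) (i2 v) i3
      (fun z hz => (hUd z (hχs hz)).1) fun z _ => hχ.differentiable one_ne_zero z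
  have hL : ∫ z, 2 * (A z * (p * (starRingEnd ℂ) z ^ (p - 1))) * χ z =
      (∫ z, fderiv ℝ U z 1 * χ z) + Complex.I * ∫ z, fderiv ℝ U z Complex.I * χ z := by
    rw [← MeasureTheory.integral_const_mul, ← MeasureTheory.integral_add (i1 1)
      ((i1 Complex.I).const_mul _)]
    congr 1
    funext z
    by_cases hz : z ∈ s
    · rw [(hUd z hz).2, (hUd z hz).2]
      simp only [hU', map_one, Complex.conj_I]
      linear_combination (-(deriv A z * (starRingEnd ℂ) z ^ p * χ z) + A z * (p *
        (starRingEnd ℂ) z ^ (p - 1)) * χ z + deriv B z * χ z) * Complex.I_sq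
    · rw [image_eq_zero_of_notMem_tsupport fun h => hz (hχs h)]
      ring
  have hR : ∫ z, U z * (fderiv ℝ χ z 1 + Complex.I * fderiv ℝ χ z Complex.I) =
      (∫ z, U z * fderiv ℝ χ z 1) + Complex.I * ∫ z, U z * fderiv ℝ χ z Complex.I := by
    rw [← MeasureTheory.integral_const_mul, ← MeasureTheory.integral_add (i2 1)
      ((i2 Complex.I).const_mul _)]
    congr 1
    funext z
    ring
  rw [hL, hR, key, key]
  ring

namespace IsSmoothBoundedDomain

variable {Ω : Set ℂ} {n : ℕ} {γ : Fin n → ℝ → ℂ}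

/-- If `A z̄ ^ p` has a holomorphic extension `B` from the boundary, then the integral of its
Cauchy–Riemann derivative over the domain vanishes. -/
theorem integral_dbar_eq_zero (hΩ : IsSmoothBoundedDomain Ω γ) {A B : ℂ → ℂ}
    (hA : DifferentiableOn ℂ A Ω) (hAc : ContinuousOn A (closure Ω))
    (hB : DifferentiableOn ℂ B Ω) (hBc : ContinuousOn B (closure Ω)) (p : ℕ)
    (hAB : ∀ z ∈ frontier Ω, A z * (starRingEnd ℂ) z ^ p = B z) :
    ∫ z in Ω, A z * (p * (starRingEnd ℂ) z ^ (p - 1)) = 0 := by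
  set U : ℂ → ℂ := fun z => A z * (starRingEnd ℂ) z ^ p - B z with hU
  set Φ : ℂ → ℂ := fun z => 2 * (A z * (p * (starRingEnd ℂ) z ^ (p - 1))) with hΦ
  have hconj : ContinuousOn (fun z : ℂ => (starRingEnd ℂ) z) (closure Ω) :=
    Complex.continuous_conj.continuousOn
  have hUc : ContinuousOn U (closure Ω) := (hAc.mul (hconj.pow p)).sub hBc
  have hΦc : ContinuousOn Φ (closure Ω) :=
    continuousOn_const.mul (hAc.mul (continuousOn_const.mul (hconj.pow (p - 1))))
  have hΩm : MeasurableSet Ω := hΩ.isOpen.measurableSet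
  obtain ⟨C₁, hC₁, hmoll⟩ := exists_mollified_indicator
  obtain ⟨C₂, hC₂, hvol⟩ := hΩ.volume_cthickening_frontier_le
  obtain ⟨M, hM⟩ := hΩ.isCompact_closure.exists_bound_of_continuousOn hΦc
  have hM0 : 0 ≤ M := by
    obtain ⟨z, hz⟩ := hΩ.isConnected.nonempty
    exact (norm_nonneg _).trans (hM z (subset_closure hz))
  have hcne : (Ωᶜ).Nonempty := nonempty_compl.2 hΩ.ne_univ
  have hunif := hΩ.isCompact_closure.uniformContinuousOn_of_continuous hUc
  rw [Metric.uniformContinuousOn_iff] at hunif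
  have hΦint : MeasureTheory.IntegrableOn Φ Ω :=
    (hΦc.integrableOn_compact hΩ.isCompact_closure).mono_set subset_closure
  -- Only continuity of `A` and `B` up to the boundary is available, so the boundary is approached
  -- through a cutoff. On a strip of width of order `ε`, `U` is at most `η`, the gradient of the
  -- cutoff is of order `1 / ε` and the area is of order `ε`.
  have main : ∀ η > 0, ‖∫ z in Ω, Φ z‖ ≤ (6 * M * C₂ + 6 * C₁ * C₂) * η := by
    intro η hη
    obtain ⟨d, hd, hdU⟩ := hunif η hη
    obtain ⟨ε, hε, hε'⟩ := exists_between (lt_min (lt_min hη (by positivity : 0 < d / 3))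
      (by norm_num : (0 : ℝ) < 1 / 3))
    simp only [lt_min_iff] at hε'
    obtain ⟨⟨hεη, hεd⟩, hε3⟩ := hε'
    -- Thresholding at `2ε` and mollifying at scale `ε` makes `χ` vanish within `ε` of the
    -- complement and equal `1` beyond `3ε`, so its gradient lives on `S`.
    obtain ⟨χ, hχ, hχd, hχ1, hχ0, hχ2⟩ := hmoll ε hε {z | 2 * ε < Metric.infDist z Ωᶜ}
      (measurableSet_lt measurable_const (Metric.continuous_infDist_pt _).measurable)
    set S : Set ℂ := Ω ∩ {z | Metric.infDist z Ωᶜ ≤ 3 * ε} with hS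
    have hSm : MeasurableSet S := hΩm.inter
      (measurableSet_le (Metric.continuous_infDist_pt _).measurable measurable_const)
    have hSnear : ∀ z ∈ S, ∃ y ∈ frontier Ω, dist z y ≤ 3 * ε := by
      rintro z ⟨hz, hz'⟩
      obtain ⟨y, hy, he⟩ := exists_mem_frontier_infDist_compl_eq_dist hz hΩ.ne_univ
      exact ⟨y, hy, he ▸ hz'⟩
    have hSvol : MeasureTheory.volume S ≤ ENNReal.ofReal (C₂ * (3 * ε)) := by
      refine le_trans (MeasureTheory.measure_mono fun z hz => ?_)
        (hvol (3 * ε) (by positivity) (by linarith))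
      obtain ⟨y, hy, hzy⟩ := hSnear z hz
      exact Metric.mem_cthickening_of_dist_le z y _ _ hy hzy
    have hStop : MeasureTheory.volume S < ⊤ := hSvol.trans_lt ENNReal.ofReal_lt_top
    have hSreal : MeasureTheory.volume.real S ≤ C₂ * (3 * ε) :=
      ENNReal.toReal_le_of_le_ofReal (by positivity) hSvol
    have hUS : ∀ z ∈ S, ‖U z‖ ≤ η := by
      intro z hz
      obtain ⟨y, hy, hzy⟩ := hSnear z hz
      have hUy : U y = 0 := by simp only [hU, hAB y hy, sub_self]
      have := hdU z (subset_closure hz.1) y (frontier_subset_closure hy) (by linarith)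
      rw [hUy, dist_zero_right] at this
      exact this.le
    have hsupp : tsupport χ ⊆ {z | ε ≤ Metric.infDist z Ωᶜ} := by
      refine closure_minimal (fun z hz => ?_)
        (isClosed_le continuous_const (Metric.continuous_infDist_pt _))
      by_contra hlt
      simp only [mem_ofPred_eq, not_le] at hlt
      refine hz (hχ0 z (disjoint_left.2 fun w hw hw' => ?_))
      have h1 := Metric.infDist_le_infDist_add_dist (s := Ωᶜ) (x := w) (y := z)
      have h2 := Metric.mem_ball.1 hw
      have h3 : 2 * ε < Metric.infDist w Ωᶜ := hw'
      linarith
    have hsub : {z | ε ≤ Metric.infDist z Ωᶜ} ⊆ Ω := by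
      intro z hz
      by_contra hzΩ
      have h1 : ε ≤ Metric.infDist z Ωᶜ := hz
      rw [Metric.infDist_zero_of_mem (mem_compl hzΩ)] at h1
      linarith
    have hχs : tsupport χ ⊆ Ω := hsupp.trans hsub
    have hχc : HasCompactSupport χ :=
      hΩ.isCompact_closure.of_isClosed_subset (isClosed_tsupport χ) (hχs.trans subset_closure)
    have hχone : ∀ z, 3 * ε ≤ Metric.infDist z Ωᶜ → χ z = 1 := by
      intro z hz
      refine hχ1 z fun w hw => ?_
      have h1 := Metric.infDist_le_infDist_add_dist (s := Ωᶜ) (x := z) (y := w)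
      have h2 := Metric.mem_ball'.1 hw
      simp only [mem_ofPred_eq]
      linarith
    have hχflat : ∀ z, z ∉ S → fderiv ℝ χ z = 0 := by
      intro z hz
      by_cases hzΩ : z ∈ Ω
      · have h3 : 3 * ε < Metric.infDist z Ωᶜ := by
          by_contra! h
          exact hz ⟨hzΩ, h⟩
        have hev : χ =ᶠ[𝓝 z] fun _ => 1 := by
          filter_upwards [(isOpen_lt continuous_const
            (Metric.continuous_infDist_pt Ωᶜ)).mem_nhds h3] with w hw
          exact hχone w (le_of_lt hw)
        rw [hev.fderiv_eq, fderiv_const_apply]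
      · exact image_eq_zero_of_notMem_tsupport fun h => hzΩ (hχs (tsupport_fderiv_subset ℝ h))
    have hIBP := integral_dbar_mul_cutoff hΩ.isOpen hA hB p hχ hχc hχs
    have hsecond : ‖∫ z, Φ z * χ z‖ ≤ 6 * C₁ * C₂ * η := by
      rw [hIBP, norm_neg, ← MeasureTheory.setIntegral_eq_integral_of_forall_compl_eq_zero (s := S)
        fun z hz => by rw [hχflat z hz]; simp]
      have hb : ∀ z ∈ S, ‖U z * (fderiv ℝ χ z 1 + Complex.I * fderiv ℝ χ z Complex.I)‖ ≤
          η * (C₁ / ε + C₁ / ε) := by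
        intro z hz
        have hv : ∀ v : ℂ, ‖v‖ = 1 → ‖fderiv ℝ χ z v‖ ≤ C₁ / ε := fun v hv =>
          ((fderiv ℝ χ z).le_opNorm v).trans (by rw [hv, mul_one]; exact hχd z)
        rw [norm_mul]
        refine mul_le_mul (hUS z hz) ((norm_add_le _ _).trans (add_le_add (hv 1 norm_one) ?_))
          (norm_nonneg _) hη.le
        rw [norm_mul, Complex.norm_I, one_mul]
        exact hv _ Complex.norm_I
      refine (MeasureTheory.norm_setIntegral_le_of_norm_le_const hStop hb).trans ?_
      calc η * (C₁ / ε + C₁ / ε) * MeasureTheory.volume.real S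
          ≤ η * (C₁ / ε + C₁ / ε) * (C₂ * (3 * ε)) := by gcongr
        _ = 6 * C₁ * C₂ * η := by field_simp; ring
    have hχint : MeasureTheory.IntegrableOn (fun z => Φ z * χ z) Ω :=
      ((hΦc.mul hχ.continuous.continuousOn).integrableOn_compact
        hΩ.isCompact_closure).mono_set subset_closure
    have hsplit : ∫ z in Ω, Φ z = (∫ z in Ω, Φ z * (1 - χ z)) + ∫ z, Φ z * χ z := by
      rw [← MeasureTheory.setIntegral_eq_integral_of_forall_compl_eq_zero (s := Ω)
        (f := fun z => Φ z * χ z) fun z hz => by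
          rw [image_eq_zero_of_notMem_tsupport fun h => hz (hχs h), mul_zero],
        ← MeasureTheory.integral_add _ hχint]
      · congr 1
        funext z
        ring
      · have := hΦint.sub hχint
        refine this.congr (Eventually.of_forall fun z => ?_)
        simp only [Pi.sub_apply]
        ring
    have hfirst : ‖∫ z in Ω, Φ z * (1 - χ z)‖ ≤ 6 * M * C₂ * η := by
      rw [MeasureTheory.setIntegral_eq_of_subset_of_forall_sdiff_eq_zero hΩm
        (inter_subset_left : S ⊆ Ω) fun z hz => by
          rw [hχone z (by
            by_contra! h
            exact hz.2 ⟨hz.1, h.le⟩), sub_self, mul_zero]]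
      refine (MeasureTheory.norm_setIntegral_le_of_norm_le_const (C := M * 2) hStop
        fun z hz => ?_).trans ?_
      · rw [norm_mul]
        exact mul_le_mul (hM z (subset_closure hz.1)) (hχ2 z) (norm_nonneg _) hM0
      · calc M * 2 * MeasureTheory.volume.real S ≤ M * 2 * (C₂ * (3 * ε)) := by gcongr
          _ ≤ M * 2 * (C₂ * (3 * η)) := by gcongr
          _ = _ := by ring
    rw [hsplit]
    calc _ ≤ _ := norm_add_le _ _
      _ ≤ 6 * M * C₂ * η + 6 * C₁ * C₂ * η := add_le_add hfirst hsecond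
      _ = _ := by ring
  have hzero : ‖∫ z in Ω, Φ z‖ ≤ 0 := by
    have hK : 0 ≤ 6 * M * C₂ + 6 * C₁ * C₂ := by positivity
    refine le_of_forall_pos_le_add fun τ hτ => ?_
    refine (main (τ / (6 * M * C₂ + 6 * C₁ * C₂ + 1)) (by positivity)).trans ?_
    rw [zero_add, mul_div_assoc', div_le_iff₀ (by positivity)]
    nlinarith
  have h2 : ∫ z in Ω, Φ z = 2 * ∫ z in Ω, A z * (p * (starRingEnd ℂ) z ^ (p - 1)) :=
    MeasureTheory.integral_const_mul _ _
  have h3 := norm_le_zero_iff.1 hzero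
  rw [h2] at h3
  simpa using h3

end IsSmoothBoundedDomain

/-! ### The quadrature identities -/

lemma pow_mul_conj_pow (z : ℂ) (k : ℕ) :
    z ^ k * (starRingEnd ℂ) z ^ k = ((‖z‖ ^ (2 * k) : ℝ) : ℂ) := by
  rw [← mul_pow, Complex.mul_conj, Complex.normSq_eq_norm_sq, pow_mul]
  push_cast
  rfl

lemma setIntegral_norm_pow_pos {s : Set ℂ} (hs : IsOpen s) (hne : s.Nonempty)
    (hb : Bornology.IsBounded s) (k : ℕ) : 0 < ∫ z in s, ‖z‖ ^ k := by
  have hint : MeasureTheory.IntegrableOn (fun z : ℂ => ‖z‖ ^ k) s :=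
    ((continuous_norm.pow k).continuousOn.integrableOn_compact
      hb.isCompact_closure).mono_set subset_closure
  rw [MeasureTheory.setIntegral_pos_iff_support_of_nonneg_ae
    (Eventually.of_forall fun z => by positivity) hint]
  have h1 : 0 < MeasureTheory.volume (s \ {0}) := by
    rw [MeasureTheory.measure_sdiff_null (by simp)]
    exact hs.measure_pos _ hne
  refine h1.trans_le (MeasureTheory.measure_mono fun z hz => ⟨?_, hz.1⟩)
  exact pow_ne_zero _ (norm_ne_zero_iff.2 hz.2)

/-- These Cauchy kernels are the only test functions to which the boundary identity is applied. -/
lemma inv_sub_mem_testClass {s : Set ℂ} {w : ℂ} (hw : w ∉ closure s) :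
    (fun z => (z - w)⁻¹) ∈ testClass s := by
  have hne : ∀ z ∈ closure s, z - w ≠ 0 := fun z hz h => hw (sub_eq_zero.1 h ▸ hz)
  exact ⟨(differentiableOn_id.sub_const w).inv fun z hz => hne z (subset_closure hz),
    (contDiffOn_id.sub contDiffOn_const).inv hne⟩

/-- A quadrature domain for `|z|^{-2p} dz` with node `0` carries a holomorphic function with
boundary values `z |z|^{-2p}` that does not vanish at `0`. -/
lemma IsSmoothBoundedDomain.exists_holomorphic_of_isOnePointQDBoundary {Ω : Set ℂ} {n : ℕ}
    {γ : Fin n → ℝ → ℂ} (hΩ : IsSmoothBoundedDomain Ω γ) {p : ℕ}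
    (hQ : IsOnePointQDBoundary Ω γ p 0) :
    ∃ G : ℂ → ℂ, DifferentiableOn ℂ G Ω ∧ ContinuousOn G (closure Ω) ∧ G 0 ≠ 0 ∧
      ∀ z ∈ frontier Ω, G z = (((‖z‖ ^ (2 * p))⁻¹ : ℝ) : ℂ) * z := by
  obtain ⟨h0, c, hc, hQ⟩ := hQ
  have hz0 : ∀ z ∈ frontier Ω, z ≠ 0 := fun z hz h =>
    hΩ.notMem_of_mem_frontier hz (h ▸ h0)
  have hφ : ContinuousOn (fun z : ℂ => (((‖z‖ ^ (2 * p))⁻¹ : ℝ) : ℂ)) (frontier Ω) :=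
    Complex.continuous_ofReal.comp_continuousOn
      ((continuous_norm.pow _).continuousOn.inv₀ fun z hz =>
        pow_ne_zero _ (norm_ne_zero_iff.2 (hz0 z hz)))
  obtain ⟨h, hd, hcont, hfr⟩ := hΩ.exists_holomorphic_extension (E := fun w => c * (0 - w)⁻¹) hφ
    (fun z hz => continuousAt_const.mul
      ((continuousAt_const.sub continuousAt_id).inv₀ (by simpa using hz0 z hz)))
    (fun w hw => by
      rw [← hQ _ (inv_sub_mem_testClass hw)]
      congr 1
      funext z
      rw [Complex.ofReal_inv]
      field_simp)
  have hκ : (2 * Real.pi * Complex.I : ℂ) ≠ 0 := Complex.two_pi_I_ne_zero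
  -- On the frontier `h = |z|^{-2p} - c / (2πi z)`; multiplying by `z` clears the pole, and the
  -- added constant removes the second term and becomes the value at `0`.
  refine ⟨fun z => z * h z + c / (2 * Real.pi * Complex.I),
    (differentiableOn_id.mul hd).add_const _, (continuousOn_id.mul hcont).add continuousOn_const,
    ?_, fun z hz => ?_⟩
  · simpa using hc
  · have hz := hfr z hz
    have hzne := hz0 z ‹_›
    simp only [hz]
    rw [zero_sub, inv_neg]
    field_simp
    ring

theorem mainTheorem11 (p : ℕ) (hp : 1 ≤ p) (Ω : Set ℂ) (n : ℕ) (γ : Fin n → ℝ → ℂ)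
    (hΩ : IsSmoothBoundedDomain Ω γ) (hQ : IsOnePointQDBoundary Ω γ p 0) :
    ∃ z₀ : ℂ, z₀ ≠ 0 ∧ IsOnePointQDArea Ω (2 * p - 2) z₀ := by
  obtain ⟨G, hGd, hGc, hG0, hGfr⟩ := hΩ.exists_holomorphic_of_isOnePointQDBoundary hQ
  have hfr0 : ∀ z ∈ frontier Ω, z ≠ 0 := fun z hz h =>
    hΩ.notMem_of_mem_frontier hz (h ▸ hQ.1)
  have hGne : ∀ z ∈ frontier Ω, G z ≠ 0 := fun z hz => by
    rw [hGfr z hz]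
    have := hfr0 z hz
    have := norm_ne_zero_iff.2 this
    refine mul_ne_zero (by exact_mod_cast inv_ne_zero (pow_ne_zero _ this)) (hfr0 z hz)
  have hpp : p - 1 + 1 = p := Nat.sub_add_cancel hp
  have hbdry : ∀ z ∈ frontier Ω, z ^ (p - 1) * (starRingEnd ℂ) z ^ p = (G z)⁻¹ := by
    intro z hz
    rw [hGfr z hz, Complex.ofReal_inv, ← pow_mul_conj_pow, mul_inv, inv_inv]
    nth_rewrite 3 [← hpp]
    rw [pow_succ]
    have := hfr0 z hz
    field_simp
  have h2p : 2 * p - 2 = 2 * (p - 1) := by omega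
  have hweight : ∀ z : ℂ, z ^ (p - 1) * (p * (starRingEnd ℂ) z ^ (p - 1)) =
      p * ((‖z‖ ^ (2 * p - 2) : ℝ) : ℂ) := by
    intro z
    rw [h2p, ← pow_mul_conj_pow]
    ring
  have hp0 : (p : ℂ) ≠ 0 := by exact_mod_cast (by omega : p ≠ 0)
  have hmass : ∫ z in Ω, ((‖z‖ ^ (2 * p - 2) : ℝ) : ℂ) ≠ 0 := by
    rw [integral_complex_ofReal]
    exact_mod_cast (setIntegral_norm_pow_pos hΩ.isOpen hΩ.isConnected.nonempty hΩ.isBounded _).ne'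
  have hpow : Differentiable ℂ fun z : ℂ => z ^ (p - 1) := differentiable_pow _
  obtain ⟨z₀, hz₀, hGz₀⟩ : ∃ z ∈ Ω, G z = 0 := by
    by_contra! hcon
    have hne : ∀ z ∈ closure Ω, G z ≠ 0 := fun z hz => by
      rw [hΩ.closure_eq] at hz
      exact hz.elim (hcon z) (hGne z)
    have h := hΩ.integral_dbar_eq_zero hpow.differentiableOn hpow.continuous.continuousOn
      (hGd.inv hcon) (hGc.inv₀ hne) p hbdry
    simp only [hweight] at h
    rw [MeasureTheory.integral_const_mul] at h
    exact (mul_ne_zero hp0 hmass) h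
  refine ⟨z₀, fun h => hG0 (h ▸ hGz₀), hz₀, _, hmass, fun f hf => ?_⟩
  have hnhds : Ω ∈ 𝓝 z₀ := hΩ.isOpen.mem_nhds hz₀
  have hcnhds : closure Ω ∈ 𝓝 z₀ := mem_of_superset hnhds subset_closure
  have hfr₀ : ∀ z ∈ frontier Ω, z ≠ z₀ := fun z hz h =>
    hΩ.notMem_of_mem_frontier hz (h ▸ hz₀)
  have hds : ∀ (g : ℂ → ℂ), DifferentiableOn ℂ g Ω → ContinuousOn g (closure Ω) →
      DifferentiableOn ℂ (dslope g z₀) Ω ∧ ContinuousOn (dslope g z₀) (closure Ω) :=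
    fun g hg hgc => ⟨(Complex.differentiableOn_dslope hnhds).2 hg,
      (continuousOn_dslope hcnhds).2 ⟨hgc, (hg z₀ hz₀).differentiableAt hnhds⟩⟩
  have hfc : ContinuousOn f (closure Ω) := hf.2.continuousOn
  obtain ⟨hGd', hGc'⟩ := hds G hGd hGc
  obtain ⟨hfd', hfc'⟩ := hds f hf.1 hfc
  have hDΩ : ∀ z ∈ Ω, dslope G z₀ z ≠ 0 := fun z hz =>
    dslope_ne_zero_of_frontier_pos hΩ.isOpen hΩ.isConnected hΩ.isBounded hGd hGc
      (fun z hz => inv_pos.2 (pow_pos (norm_pos_iff.2 (hfr0 z hz)) _)) hGfr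
      (fun h => hfr0 0 h rfl) hΩ.frontier_nonempty hz₀ hz hGz₀
  have hDfr : ∀ z ∈ frontier Ω, dslope G z₀ z = G z / (z - z₀) := fun z hz => by
    rw [dslope_of_ne _ (hfr₀ z hz), slope_def_field, hGz₀, sub_zero]
  have hDne : ∀ z ∈ closure Ω, dslope G z₀ z ≠ 0 := fun z hz => by
    rw [hΩ.closure_eq] at hz
    refine hz.elim (hDΩ z) fun hz => ?_
    rw [hDfr z hz]
    exact div_ne_zero (hGne z hz) (sub_ne_zero.2 (hfr₀ z hz))
  -- `B` is `(f - f z₀) / G` with the common factor `z - z₀` removed, holomorphic since the zero of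
  -- `G` is simple and unique.
  have h := hΩ.integral_dbar_eq_zero (A := fun z => (f z - f z₀) * z ^ (p - 1))
    (B := fun z => dslope f z₀ z * (dslope G z₀ z)⁻¹) ((hf.1.sub_const _).mul hpow.differentiableOn)
    ((hfc.sub continuousOn_const).mul hpow.continuous.continuousOn) (hfd'.mul (hGd'.inv hDΩ))
    (hfc'.mul (hGc'.inv₀ hDne)) p (fun z hz => by
      rw [mul_assoc, hbdry z hz, hDfr z hz, dslope_of_ne _ (hfr₀ z hz), slope_def_field]
      have := sub_ne_zero.2 (hfr₀ z hz)
      field_simp)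
  simp only [mul_assoc, hweight] at h
  have hw : Continuous fun z : ℂ => ((‖z‖ ^ (2 * p - 2) : ℝ) : ℂ) := by fun_prop
  have hint : ∀ g : ℂ → ℂ, ContinuousOn g (closure Ω) → MeasureTheory.IntegrableOn
      (fun z => g z * ((‖z‖ ^ (2 * p - 2) : ℝ) : ℂ)) Ω := fun g hg =>
    ((hg.mul hw.continuousOn).integrableOn_compact hΩ.isCompact_closure).mono_set subset_closure
  have h2 : (p : ℂ) * ((∫ z in Ω, f z * ((‖z‖ ^ (2 * p - 2) : ℝ) : ℂ)) -
      ∫ z in Ω, f z₀ * ((‖z‖ ^ (2 * p - 2) : ℝ) : ℂ)) = 0 := by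
    rw [← MeasureTheory.integral_sub (hint f hfc) (hint (fun _ => f z₀) continuousOn_const),
      ← MeasureTheory.integral_const_mul, ← h]
    congr 1
    funext z
    ring
  have h3 := sub_eq_zero.1 ((mul_eq_zero.1 h2).resolve_left hp0)
  rw [h3, MeasureTheory.integral_const_mul, mul_comm]
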